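/- Let $k$ be a field and $n\ge 0$. Let $S=k[X_0,\dots,X_n]=\bigoplus_m S^mV$, where $V=\langle X_0,\dots,X_n\rangle$, and let $\mathbb P^n=\operatorname{Proj} S$. Let $X\subset\mathbb P^n$ be the closed subscheme defined by homogeneous polynomials $f_1,\dots,f_r\in S$, let $I=(f_1,\dots,f_r)$ be the ideal they generate, with homogeneous components $I_m=I\cap S^mV$, and let $d\ge 1$ be an integer with $d\ge\deg f_j$ for all $j$. The multiplication map $S^{d-1}V/I_{d-1}\otimes V\to S^dV/I_d$ makes $M=(S^{d-1}V/I_{d-1},\,S^dV/I_d)$ a representation of the $(n+1)$-Kronecker quiver, the $a$-th arrow acting as multiplication by $X_a$. Let $DM=\bigl((S^dV/I_d)^*,\,(S^{d-1}V/I_{d-1})^*\bigr)$ be its $k$-dual, whose arrows act by the transposed maps; it is again a representation of the $(n+1)$-Kronecker quiver. Then $X$ is isomorphic, as a $k$-scheme, to the quiver grassmannian of submodules of $DM$ of dimension vector $(1,1)$. Here the quiver grassmannian carries its natural scheme structure: it is the $k$-scheme whose $A$-points, for a commutative $k$-algebra $A$, are the pairs of rank one direct summands $N_1\subset A\otimes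 (S^dV/I_d)^*$, $N_2\subset A\otimes (S^{d-1}V/I_{d-1})^*$ such that every arrow maps $N_1$ into $N_2$. -/

import Mathlib

open CategoryTheory AlgebraicGeometry TensorProduct

universe u

/-! ### Locally split submodules of constant rank, and their base change -/

section Subbundle

variable {A : Type u} [CommRing A] {P : Type u} [AddCommGroup P] [Module A P]

/-- `N ⊆ P` is a subbundle of rank `e`: it is finitely generated, `P ⧸ N` is projective (so that
`N` is a direct summand of `P`), and `N` has rank `e` at every prime of `A`. -/
structure IsSubbundle (N : Submodule A P) (e : ℕ) : Prop where
  finite : Module.Finite A N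
  projective_quotient : Module.Projective A (P ⧸ N)
  rank_eq : ∀ p : PrimeSpectrum A, Module.rankAtStalk (R := A) N p = e

/-- A submodule with projective quotient is a direct summand. -/
lemma IsSubbundle.exists_retraction {N : Submodule A P} {e : ℕ} (h : IsSubbundle N e) :
    ∃ r : P →ₗ[A] N, r ∘ₗ N.subtype = LinearMap.id := by
  have := h.projective_quotient
  obtain ⟨s, hs⟩ := Module.projective_lifting_property N.mkQ LinearMap.id N.mkQ_surjective
  refine ⟨LinearMap.codRestrict N (LinearMap.id - s ∘ₗ N.mkQ) (fun x => ?_), ?_⟩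
  · have h1 : N.mkQ (s (N.mkQ x)) = N.mkQ x := LinearMap.congr_fun hs (N.mkQ x)
    have h2 : N.mkQ ((LinearMap.id - s ∘ₗ N.mkQ : P →ₗ[A] P) x) = 0 := by
      simp only [LinearMap.sub_apply, LinearMap.id_apply, LinearMap.comp_apply, map_sub, h1,
        sub_self]
    exact (Submodule.Quotient.mk_eq_zero N).1 h2
  · ext x
    have h1 : N.mkQ (x : P) = 0 := (Submodule.Quotient.mk_eq_zero N).2 x.2
    change (x : P) - s (N.mkQ (x : P)) = x
    rw [h1, map_zero, sub_zero]

lemma IsSubbundle.baseChange [Module.Projective A P] {N : Submodule A P} {e : ℕ}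
    (h : IsSubbundle N e) (B : Type u) [CommRing B] [Algebra A B] :
    IsSubbundle (N.baseChange B) e := by
  have hfin := h.finite
  have hproj := h.projective_quotient
  obtain ⟨r, hr⟩ := h.exists_retraction
  have hN : Module.Projective A N := Module.Projective.of_split N.subtype r hr
  have hinj : Function.Injective (N.subtype.baseChange B) := by
    have h2 : r.baseChange B ∘ₗ N.subtype.baseChange B = LinearMap.id := by
      rw [← LinearMap.baseChange_comp, hr, LinearMap.baseChange_id]
    exact fun x y hxy => by
      simpa using (LinearMap.congr_fun h2 x).symm.trans
        ((congrArg (r.baseChange B) hxy).trans (LinearMap.congr_fun h2 y))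
  let eN : (B ⊗[A] N) ≃ₗ[B] N.baseChange B := LinearEquiv.ofInjective _ hinj
  let eQ : (B ⊗[A] (P ⧸ N)) ≃ₗ[B] (B ⊗[A] P) ⧸ N.baseChange B :=
    ((Submodule.quotEquivOfEq _ _ (by
      have hex : Function.Exact N.subtype N.mkQ := LinearMap.exact_subtype_mkQ N
      have := lTensor_exact B hex N.mkQ_surjective
      ext x
      exact (this x).symm)).trans
      ((N.mkQ.baseChange B).quotKerEquivOfSurjective
        (LinearMap.baseChange_surjective B N.mkQ_surjective))).symm
  refine ⟨Module.Finite.equiv eN, Module.Projective.of_equiv eQ, fun p => ?_⟩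
  rw [← Module.rankAtStalk_eq_of_equiv eN, Module.rankAtStalk_baseChange, h.rank_eq]

lemma IsSubbundle.map_equiv {P' : Type u} [AddCommGroup P'] [Module A P'] {N : Submodule A P}
    {e : ℕ} (h : IsSubbundle N e) (E : P ≃ₗ[A] P') :
    IsSubbundle (N.map (E : P →ₗ[A] P')) e := by
  have hfin := h.finite
  have hproj := h.projective_quotient
  refine ⟨Module.Finite.equiv (E.submoduleMap N), Module.Projective.of_equiv
    (Submodule.Quotient.equiv N _ E rfl), fun p => ?_⟩
  rw [← Module.rankAtStalk_eq_of_equiv (E.submoduleMap N), h.rank_eq]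

end Subbundle

section Extend

variable {k : Type u} [Field k] {A B C : Type u} [CommRing A] [Algebra k A] [CommRing B]
  [Algebra k B] [CommRing C] [Algebra k C] {W : Type u} [AddCommGroup W] [Module k W]

/-- Base change of an `A`-submodule `N` of `A ⊗ W` along a homomorphism `f : A → B` of
`k`-algebras: the `B`-submodule of `B ⊗ W` generated by the image of `N`. -/
def extendSubmodule (f : A →ₐ[k] B) (N : Submodule A (A ⊗[k] W)) : Submodule B (B ⊗[k] W) :=
  Submodule.span B (f.toLinearMap.rTensor W '' N)

lemma rTensor_smul (f : A →ₐ[k] B) (a : A) (x : A ⊗[k] W) :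
    f.toLinearMap.rTensor W (a • x) = f a • f.toLinearMap.rTensor W x := by
  induction x using TensorProduct.induction_on with
  | zero => simp
  | tmul b w => simp [TensorProduct.smul_tmul']
  | add x y hx hy => simp only [smul_add, map_add, hx, hy]

lemma extendSubmodule_id (N : Submodule A (A ⊗[k] W)) :
    extendSubmodule (AlgHom.id k A) N = N := by
  have : ((AlgHom.id k A).toLinearMap.rTensor W : A ⊗[k] W → A ⊗[k] W) = id := by
    ext x
    simp
  rw [extendSubmodule, this, Set.image_id, Submodule.span_eq]

lemma extendSubmodule_comp (g : B →ₐ[k] C) (f : A →ₐ[k] B) (N : Submodule A (A ⊗[k] W)) :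
    extendSubmodule (g.comp f) N = extendSubmodule g (extendSubmodule f N) := by
  have hcomp : ∀ x : A ⊗[k] W, (g.comp f).toLinearMap.rTensor W x =
      g.toLinearMap.rTensor W (f.toLinearMap.rTensor W x) := fun x => by
    rw [AlgHom.comp_toLinearMap, LinearMap.rTensor_comp, LinearMap.comp_apply]
  apply le_antisymm
  · refine Submodule.span_le.2 ?_
    rintro _ ⟨x, hx, rfl⟩
    rw [hcomp]
    exact Submodule.subset_span ⟨_, Submodule.subset_span ⟨x, hx, rfl⟩, rfl⟩
  · refine Submodule.span_le.2 ?_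
    rintro _ ⟨y, hy, rfl⟩
    refine Submodule.span_induction (p := fun y _ => g.toLinearMap.rTensor W y ∈
      extendSubmodule (g.comp f) N) ?_ ?_ ?_ ?_ hy
    · rintro _ ⟨x, hx, rfl⟩
      rw [← hcomp]
      exact Submodule.subset_span ⟨x, hx, rfl⟩
    · simp
    · intro x y _ _ hx hy
      rw [map_add]
      exact add_mem hx hy
    · intro b x _ hx
      rw [rTensor_smul]
      exact Submodule.smul_mem _ _ hx

lemma IsSubbundle.extend {N : Submodule A (A ⊗[k] W)} {e : ℕ} (h : IsSubbundle N e)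
    (f : A →ₐ[k] B) : IsSubbundle (extendSubmodule f N) e := by
  let _ : Algebra A B := f.toAlgebra
  have : IsScalarTower k A B := IsScalarTower.of_algebraMap_eq' f.comp_algebraMap.symm
  have key : extendSubmodule f N = (N.baseChange B).map
      (TensorProduct.AlgebraTensorModule.cancelBaseChange k A B B W :
        B ⊗[A] (A ⊗[k] W) →ₗ[B] B ⊗[k] W) := by
    rw [Submodule.baseChange_eq_span, Submodule.map_span, extendSubmodule]
    congr 1
    rw [Submodule.map_coe, Set.image_image]
    refine Set.image_congr fun x hx => ?_
    clear hx
    induction x using TensorProduct.induction_on with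
    | zero => simp
    | tmul a w => simp [Algebra.smul_def]; rfl
    | add x y hx hy =>
      rw [map_add, hx, hy, map_add, map_add]
  rw [key]
  exact (h.baseChange B).map_equiv _

/-- A submodule inclusion `φ(N₁) ⊆ N₂` is preserved by base change. -/
lemma extendSubmodule_map_le {W' : Type u} [AddCommGroup W'] [Module k W'] (f : A →ₐ[k] B)
    (φ : W →ₗ[k] W') {N : Submodule A (A ⊗[k] W)} {N' : Submodule A (A ⊗[k] W')}
    (h : N.map (φ.baseChange A) ≤ N') :
    (extendSubmodule f N).map (φ.baseChange B) ≤ extendSubmodule f N' := by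
  rw [extendSubmodule, Submodule.map_span, Submodule.span_le]
  rintro _ ⟨_, ⟨x, hx, rfl⟩, rfl⟩
  have hcomm : φ.baseChange B (f.toLinearMap.rTensor W x) =
      f.toLinearMap.rTensor W' (φ.baseChange A x) := by
    clear hx
    induction x using TensorProduct.induction_on with
    | zero => simp
    | tmul a w => simp
    | add x y hx hy => simp only [map_add, hx, hy]
  exact Submodule.subset_span ⟨_, h ⟨x, hx, rfl⟩, hcomm.symm⟩

end Extend

/-! ### Kronecker modules and their quiver grassmannians -/

/-- A module over the Kronecker algebra with arrows indexed by `ι`, that is, a representation of the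
Kronecker quiver: vector spaces `M₁`, `M₂` and one linear map `M₁ → M₂` for each arrow. -/
structure KroneckerModule (k : Type u) [Field k] (ι : Type) where
  M₁ : Type u
  M₂ : Type u
  [addCommGroup₁ : AddCommGroup M₁]
  [addCommGroup₂ : AddCommGroup M₂]
  [module₁ : Module k M₁]
  [module₂ : Module k M₂]
  arrow : ι → M₁ →ₗ[k] M₂

attribute [instance] KroneckerModule.addCommGroup₁ KroneckerModule.addCommGroup₂
  KroneckerModule.module₁ KroneckerModule.module₂

namespace KroneckerModule

variable {k : Type u} [Field k] {ι : Type}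

/-- The `k`-dual of a Kronecker module: dual spaces and transposed maps. (The Kronecker quiver is
its own opposite, after exchanging the two vertices.) -/
def dual (M : KroneckerModule k ι) : KroneckerModule k ι where
  M₁ := Module.Dual k M.M₂
  M₂ := Module.Dual k M.M₁
  arrow a := (M.arrow a).dualMap

/-- The `A`-points of the quiver grassmannian of submodules of `M` of dimension vector `(e₁, e₂)`:
pairs of subbundles of `A ⊗ M₁`, `A ⊗ M₂` of ranks `e₁`, `e₂` that are stable under all arrows. -/
@[ext]
structure SubmodulePoint (M : KroneckerModule k ι) (e₁ e₂ : ℕ) (A : Type u) [CommRing A]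
    [Algebra k A] where
  N₁ : Submodule A (A ⊗[k] M.M₁)
  N₂ : Submodule A (A ⊗[k] M.M₂)
  isSubbundle₁ : IsSubbundle N₁ e₁
  isSubbundle₂ : IsSubbundle N₂ e₂
  map_le : ∀ a : ι, N₁.map ((M.arrow a).baseChange A) ≤ N₂

/-- Base change of points of the quiver grassmannian. -/
def SubmodulePoint.extend {M : KroneckerModule k ι} {e₁ e₂ : ℕ} {A B : Type u} [CommRing A]
    [Algebra k A] [CommRing B] [Algebra k B] (f : A →ₐ[k] B) (N : M.SubmodulePoint e₁ e₂ A) :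
    M.SubmodulePoint e₁ e₂ B where
  N₁ := extendSubmodule f N.N₁
  N₂ := extendSubmodule f N.N₂
  isSubbundle₁ := N.isSubbundle₁.extend f
  isSubbundle₂ := N.isSubbundle₂.extend f
  map_le a := extendSubmodule_map_le f (M.arrow a) (N.map_le a)

/-- The functor of points (on commutative `k`-algebras) of the quiver grassmannian of submodules of
`M` of dimension vector `(e₁, e₂)`. -/
def grassmannianFunctor (M : KroneckerModule k ι) (e₁ e₂ : ℕ) :
    CommAlgCat.{u} (CommRingCat.of k) ⥤ Type u where
  obj A := M.SubmodulePoint (k := k) e₁ e₂ A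
  map {A B} f := ↾(SubmodulePoint.extend (k := k) f.hom)
  map_id A := by
    apply ConcreteCategory.hom_ext
    intro N
    exact SubmodulePoint.ext (k := k) (extendSubmodule_id (k := k) N.N₁)
      (extendSubmodule_id (k := k) N.N₂)
  map_comp f g := by
    apply ConcreteCategory.hom_ext
    intro N
    exact SubmodulePoint.ext (k := k) (extendSubmodule_comp (k := k) g.hom f.hom N.N₁)
      (extendSubmodule_comp (k := k) g.hom f.hom N.N₂)

end KroneckerModule

/-- The functor of points `A ↦ Hom_k(Spec A, X)` of a `k`-scheme, on commutative `k`-algebras. -/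
noncomputable def schemePoints {k : Type u} [Field k] (X : Over (Spec (CommRingCat.of k))) :
    CommAlgCat.{u} (CommRingCat.of k) ⥤ Type u :=
  (algSpec (CommRingCat.of k)).rightOp ⋙ yoneda.obj X

/-- The `k`-scheme `X` is (isomorphic to) the quiver grassmannian of submodules of `M` of dimension
vector `(e₁, e₂)`, with its natural scheme structure: `X` represents the functor of families of
submodules of `M` of that dimension vector. A `k`-scheme is determined by its functor of points on
commutative `k`-algebras. -/
def IsQuiverGrassmannian {k : Type u} [Field k] {ι : Type} (X : Over (Spec (CommRingCat.of k)))
    (M : KroneckerModule k ι) (e₁ e₂ : ℕ) : Prop :=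
  Nonempty (schemePoints X ≅ M.grassmannianFunctor e₁ e₂)

/-! ### Projective space and its closed subschemes -/

attribute [local instance] MvPolynomial.gradedAlgebra

/-- The grading `S = ⨁ S^m V` of the polynomial ring in `X₀, …, Xₙ`, with `V` the span of the
variables. -/
abbrev polyGrading (n : ℕ) (k : Type u) [Field k] :
    ℕ → Submodule k (MvPolynomial (Fin (n + 1)) k) :=
  MvPolynomial.homogeneousSubmodule (Fin (n + 1)) k

/-- The `n`-dimensional projective space over `k`. -/
noncomputable def projectiveSpace (n : ℕ) (k : Type u) [Field k] : Scheme.{u} :=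
  Proj (polyGrading n k)

/-- The structure morphism of projective space. -/
noncomputable def projectiveSpaceToSpec (n : ℕ) (k : Type u) [Field k] :
    projectiveSpace n k ⟶ Spec (CommRingCat.of k) :=
  Proj.toSpecZero (polyGrading n k) ≫
    Spec.map (CommRingCat.ofHom (algebraMap k (polyGrading n k 0)))

/-- The standard affine open `D₊(X_a)` of projective space. -/
noncomputable def standardOpen (n : ℕ) (k : Type u) [Field k] (a : Fin (n + 1)) :
    (projectiveSpace n k).Opens :=
  Proj.basicOpen (polyGrading n k) (MvPolynomial.X a)

/-- The function `f / X_a ^ m` on `D₊(X_a)`, for `f` homogeneous of degree `m`. -/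
noncomputable def dehomogenize {n : ℕ} {k : Type u} [Field k] (a : Fin (n + 1))
    {f : MvPolynomial (Fin (n + 1)) k} {m : ℕ} (hf : f.IsHomogeneous m) :
    Γ(projectiveSpace n k, standardOpen n k a) :=
  (Proj.awayToSection (polyGrading n k) (MvPolynomial.X a)).hom
    (HomogeneousLocalization.mk
      { deg := m
        num := ⟨f, hf⟩
        den := ⟨MvPolynomial.X a ^ m, MvPolynomial.isHomogeneous_X_pow a m⟩
        den_mem := ⟨m, rfl⟩ })

/-- The closed subscheme `i : X ⟶ ℙⁿ` is defined by the homogeneous polynomials `f j`: on each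
standard affine open `D₊(X_a)` the ideal of `X` is generated by the `f j / X_a ^ deg (f j)`. -/
def IsDefinedBy {n : ℕ} {k : Type u} [Field k] {X : Scheme.{u}} (i : X ⟶ projectiveSpace n k)
    {r : ℕ} (f : Fin r → MvPolynomial (Fin (n + 1)) k) (deg : Fin r → ℕ)
    (hf : ∀ j, (f j).IsHomogeneous (deg j)) : Prop :=
  ∀ a : Fin (n + 1), RingHom.ker (i.app (standardOpen n k a)).hom =
    Ideal.span (Set.range fun j => dehomogenize a (hf j))

/-! ### The Kronecker module of a homogeneous ideal -/

/-- The component `I_m = I ∩ S^m V`. -/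
noncomputable def idealPiece {n : ℕ} {k : Type u} [Field k] (I : Ideal (MvPolynomial (Fin (n + 1)) k)) (m : ℕ) :
    Submodule k (polyGrading n k m) :=
  (I.restrictScalars k).comap (polyGrading n k m).subtype

/-- Multiplication by `X_a` as a map `S^{d-1} V → S^d V`. -/
noncomputable def mulVar {n : ℕ} {k : Type u} [Field k] (d : ℕ) (hd : 1 ≤ d) (a : Fin (n + 1)) :
    polyGrading n k (d - 1) →ₗ[k] polyGrading n k d :=
  (LinearMap.mulLeft k (MvPolynomial.X a : MvPolynomial (Fin (n + 1)) k)).restrict (fun p hp => by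
    have h := (MvPolynomial.isHomogeneous_X k a).mul
      ((MvPolynomial.mem_homogeneousSubmodule _ _).1 hp)
    rw [Nat.add_sub_cancel' hd] at h
    exact h)

/-- The `(n+1)`-Kronecker module `(S^{d-1} V / I_{d-1}, S^d V / I_d)`, whose arrows are the
multiplications by `X₀, …, Xₙ`. -/
noncomputable def multiplicationModule {n : ℕ} {k : Type u} [Field k]
    (I : Ideal (MvPolynomial (Fin (n + 1)) k)) (d : ℕ) (hd : 1 ≤ d) :
    KroneckerModule k (Fin (n + 1)) where
  M₁ := polyGrading n k (d - 1) ⧸ idealPiece I (d - 1)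
  M₂ := polyGrading n k d ⧸ idealPiece I d
  arrow a := Submodule.mapQ _ _ (mulVar d hd a) (fun _ hp => I.mul_mem_left (MvPolynomial.X a) hp)

/-! Both functors are described by tuples x = (x_0, …, x_n) over a k-algebra A that have a unit
entry and satisfy f_j(x) = 0 for all j, taken up to multiplication by a unit. On the side of X this
is the usual description of a morphism from Spec A that lands in a standard chart
(`IsDefinedBy.exists_tuple`, `IsDefinedBy.exists_lift`).

From tuples to submodules: view A ⊗ (S^m V/I_m)* as the k-linear maps S^m V/I_m → A. Evaluation at x
is such a map, because x is a zero of I. It takes the unit value x_a^m at X_a^m, so it spans a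
direct summand of rank one. The identity (X_c q)(x) = x_c q(x) says that the c-th transposed arrow
sends evaluation in degree d to x_c times evaluation in degree d-1.

From submodules to tuples: locally N₁ and N₂ are spanned by unimodular functionals v and w, and
v(X_c q) = x_c w(q) for some scalars x_c. Forms of degree d ≥ 1 are sums of products X_c q, so the
values of v lie in the ideal (x_0, …, x_n), which is therefore the unit ideal; after localizing,
some x_a is a unit. Computing v(X_a X_c q) in two ways gives x_a w(X_c q) = x_c w(X_a q). Trading
variables for X_a one at a time yields x_a^{d-1} w(q) = q(x) w(X_a^{d-1}), and similarly for v
(`pow_mul_apply_eq_of_X_mul`, `pow_mul_apply_eq_of_X_mul'`). Unimodularity makes the factors units,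
so N₁ and N₂ are spanned by the evaluations at x. As d ≥ deg f_j, the form X_a^{d - deg f_j} f_j
lies in I_d and is killed by v, whence f_j(x) = 0 (`exists_tuplePoint_eq`).

Tuples exist only locally, so having a common tuple is a relation (`TupleRel`) that is locally the
graph of a map in both directions. Since both functors are Zariski sheaves, the local bijections
glue to an isomorphism (`IsLocalGraph.nonempty_iso`). -/

/-! ### Zariski sheaves on commutative algebras -/

namespace ZariskiLocal

variable {R : Type u} [CommRing R]

/-- The localization `A_h` as a commutative `R`-algebra. -/
abbrev awayObj (A : CommAlgCat.{u} R) (h : A) : CommAlgCat.{u} R :=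
  CommAlgCat.of R (Localization.Away h)

/-- The localization map `A ⟶ A_h`. -/
noncomputable abbrev toAway (A : CommAlgCat.{u} R) (h : A) : A ⟶ awayObj A h :=
  CommAlgCat.ofHom (IsScalarTower.toAlgHom R A (Localization.Away h))

lemma isUnit_toAway (A : CommAlgCat.{u} R) (h : A) : IsUnit ((toAway A h).hom h) :=
  IsLocalization.Away.algebraMap_isUnit h

lemma exists_toAway_comp_eq {A B : CommAlgCat.{u} R} (h : A) (f : A ⟶ B)
    (hf : IsUnit (f.hom h)) : ∃ g : awayObj A h ⟶ B, toAway A h ≫ g = f := by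
  have hu : ∀ y : Submonoid.powers h, IsUnit (f.hom y) := by
    rintro ⟨_, n, rfl⟩
    simpa using hf.pow n
  refine ⟨CommAlgCat.ofHom (IsLocalization.liftAlgHom (M := Submonoid.powers h)
    (f := f.hom) hu), ?_⟩
  ext x
  simp

/-- A property of morphisms out of `A` holds locally if it holds for the localizations `A ⟶ A_h`,
for a family of `h` generating the unit ideal. -/
def Locally (A : CommAlgCat.{u} R) (P : ∀ ⦃B : CommAlgCat.{u} R⦄, (A ⟶ B) → Prop) : Prop :=
  Ideal.span {h : A | P (toAway A h)} = ⊤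

/-- A property of morphisms out of `A` that is stable under composition. -/
def Stable {A : CommAlgCat.{u} R} (P : ∀ ⦃B : CommAlgCat.{u} R⦄, (A ⟶ B) → Prop) : Prop :=
  ∀ ⦃B C : CommAlgCat.{u} R⦄ (f : A ⟶ B) (g : B ⟶ C), P f → P (f ≫ g)

variable {A : CommAlgCat.{u} R}

lemma Stable.toAway_of_isUnit {P : ∀ ⦃B : CommAlgCat.{u} R⦄, (A ⟶ B) → Prop} (hP : Stable P)
    {h : A} (hh : P (toAway A h)) {B : CommAlgCat.{u} R} (f : A ⟶ B) (hf : IsUnit (f.hom h)) :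
    P f := by
  obtain ⟨g, rfl⟩ := exists_toAway_comp_eq h f hf
  exact hP _ _ hh

/-- An ideal is the unit ideal exactly when no prime contains it. This turns covers into a pointwise
condition, which is easier to combine. -/
lemma locally_iff_forall_prime {P : ∀ ⦃B : CommAlgCat.{u} R⦄, (A ⟶ B) → Prop} :
    Locally A P ↔ ∀ p : Ideal A, p.IsPrime → ∃ h, h ∉ p ∧ P (toAway A h) := by
  constructor
  · intro H p hp
    by_contra! hc
    refine hp.ne_top (top_le_iff.1 (H.symm.le.trans (Ideal.span_le.2 fun h hh => ?_)))
    by_contra hn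
    exact hc h hn hh
  · intro H
    by_contra hc
    obtain ⟨m, hm, hle⟩ := Ideal.exists_le_maximal _ hc
    obtain ⟨h, hh, hP⟩ := H m hm.isPrime
    exact hh (hle (Ideal.subset_span hP))

lemma Locally.mono {P Q : ∀ ⦃B : CommAlgCat.{u} R⦄, (A ⟶ B) → Prop}
    (h : Locally A P) (hPQ : ∀ ⦃B : CommAlgCat.{u} R⦄ (f : A ⟶ B), P f → Q f) : Locally A Q :=
  top_le_iff.1 (h.symm.le.trans (Ideal.span_mono fun _ hx => hPQ _ hx))

lemma Locally.and {P Q : ∀ ⦃B : CommAlgCat.{u} R⦄, (A ⟶ B) → Prop} (h : Locally A P)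
    (h' : Locally A Q) (hP : Stable P) (hQ : Stable Q) : Locally A fun _ f => P f ∧ Q f := by
  rw [locally_iff_forall_prime] at *
  intro p hp
  obtain ⟨a, ha, hPa⟩ := h p hp
  obtain ⟨b, hb, hQb⟩ := h' p hp
  refine ⟨a * b, fun hab => (hp.mem_or_mem hab).elim ha hb, hP.toAway_of_isUnit hPa _ ?_,
    hQ.toAway_of_isUnit hQb _ ?_⟩
  · exact isUnit_of_mul_isUnit_left (map_mul (toAway A (a * b)).hom a b ▸ isUnit_toAway A (a * b))
  · exact isUnit_of_mul_isUnit_right (map_mul (toAway A (a * b)).hom a b ▸ isUnit_toAway A (a * b))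

/-- At a prime of B, use the element found at its preimage in A; its image in B avoids the given
prime. -/
lemma Locally.comp {P : ∀ ⦃B : CommAlgCat.{u} R⦄, (A ⟶ B) → Prop} (h : Locally A P)
    (hP : Stable P) {B : CommAlgCat.{u} R} (f : A ⟶ B) :
    Locally B fun _ g => P (f ≫ g) := by
  rw [locally_iff_forall_prime] at *
  intro p hp
  obtain ⟨a, ha, hPa⟩ := h (p.comap f.hom) inferInstance
  exact ⟨f.hom a, ha, hP.toAway_of_isUnit hPa _ (isUnit_toAway B (f.hom a))⟩

/-- An iterated localization (A_a)_b with b = c/s maps to A_{ac}, so stability carries the property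
there. Only the numerator c matters, as s is already invertible. -/
lemma Locally.trans {P : ∀ ⦃B : CommAlgCat.{u} R⦄, (A ⟶ B) → Prop} (hP : Stable P)
    (h : Locally A fun B f => Locally B fun _ g => P (f ≫ g)) : Locally A P := by
  rw [locally_iff_forall_prime] at *
  intro p hp
  obtain ⟨a, ha, hPa⟩ := h p hp
  rw [locally_iff_forall_prime] at hPa
  have hdisj : Disjoint (Submonoid.powers a : Set A) p :=
    (Ideal.disjoint_powers_iff_notMem a hp.isRadical).2 ha
  obtain ⟨b, hb, hPb⟩ := hPa (p.map (algebraMap A (Localization.Away a)))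
    (IsLocalization.isPrime_of_isPrime_disjoint (Submonoid.powers a) _ p hp hdisj)
  obtain ⟨c, s, rfl⟩ := IsLocalization.exists_mk'_eq (Submonoid.powers a) b
  have hc : c ∉ p := fun hc => hb ((IsLocalization.mk'_mem_map_algebraMap_iff
    (Submonoid.powers a) _ p c s).2 ⟨1, one_mem _, by simpa using hc⟩)
  refine ⟨a * c, fun hac => (hp.mem_or_mem hac).elim ha hc, ?_⟩
  have hu := isUnit_toAway A (a * c)
  rw [map_mul] at hu
  obtain ⟨g, hg⟩ := exists_toAway_comp_eq a (toAway A (a * c)) (isUnit_of_mul_isUnit_left hu)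
  have hg' : ∀ x : A, g.hom (algebraMap A (Localization.Away a) x) =
    (toAway A (a * c)).hom x := fun x => by rw [← hg]; rfl
  obtain ⟨g', rfl⟩ := exists_toAway_comp_eq _ g (by
    refine isUnit_of_mul_isUnit_left
      (y := g.hom (algebraMap A (Localization.Away a) s)) ?_
    rw [← map_mul, IsLocalization.mk'_spec, hg']
    exact isUnit_of_mul_isUnit_right hu)
  rw [← hg, ← Category.assoc]
  exact hP _ _ hPb

/-- A functor on commutative algebras is a Zariski sheaf if its elements are determined locally and
glue along finite covers by localizations. -/
structure IsSheaf (F : CommAlgCat.{u} R ⥤ Type u) : Prop where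
  sep : ∀ (A : CommAlgCat.{u} R) (x y : F.obj A),
    Locally A (fun _ f => F.map f x = F.map f y) → x = y
  glue : ∀ (A : CommAlgCat.{u} R) (s : Finset A), Ideal.span (s : Set A) = ⊤ →
    ∀ x : ∀ h : s, F.obj (awayObj A h.1),
    (∀ (h h' : s) (B : CommAlgCat.{u} R) (p : awayObj A h.1 ⟶ B) (q : awayObj A h'.1 ⟶ B),
      toAway A h.1 ≫ p = toAway A h'.1 ≫ q → F.map p (x h) = F.map q (x h')) →
    ∃ y : F.obj A, ∀ h : s, F.map (toAway A h.1) y = x h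

variable {F G : CommAlgCat.{u} R ⥤ Type u}

/-- A relation between the elements of two functors that locally is the graph of a map. -/
structure IsLocalGraph (rel : ∀ ⦃A : CommAlgCat.{u} R⦄, F.obj A → G.obj A → Prop) : Prop where
  map : ∀ ⦃A B : CommAlgCat.{u} R⦄ (f : A ⟶ B) (x : F.obj A) (y : G.obj A),
    rel x y → rel (F.map f x) (G.map f y)
  unique : ∀ ⦃A : CommAlgCat.{u} R⦄ (x : F.obj A) (y y' : G.obj A), rel x y → rel x y' → y = y'
  exists_locally : ∀ ⦃A : CommAlgCat.{u} R⦄ (x : F.obj A),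
    Locally A fun _ f => ∃ y, rel (F.map f x) y

/-- Two elements are locally related. -/
def LocalRel (rel : ∀ ⦃A : CommAlgCat.{u} R⦄, F.obj A → G.obj A → Prop)
    ⦃A : CommAlgCat.{u} R⦄ (x : F.obj A) (y : G.obj A) : Prop :=
  Locally A fun _ f => rel (F.map f x) (G.map f y)

namespace IsLocalGraph

variable {rel : ∀ ⦃A : CommAlgCat.{u} R⦄, F.obj A → G.obj A → Prop}

lemma stable (H : IsLocalGraph rel) (x : F.obj A) (y : G.obj A) :
    Stable fun _ (f : A ⟶ _) => rel (F.map f x) (G.map f y) := fun B C f g h => by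
  simpa using H.map g _ _ h

lemma localRel_map (H : IsLocalGraph rel) {B : CommAlgCat.{u} R} (f : A ⟶ B) {x : F.obj A}
    {y : G.obj A} (h : LocalRel rel x y) : LocalRel rel (F.map f x) (G.map f y) := by
  refine (Locally.comp h (H.stable x y) f).mono fun C g hg => ?_
  simpa using hg

lemma localRel_unique (H : IsLocalGraph rel) (hG : IsSheaf G) {x : F.obj A} {y y' : G.obj A}
    (h : LocalRel rel x y) (h' : LocalRel rel x y') : y = y' :=
  hG.sep A y y' ((Locally.and h h' (H.stable x y) (H.stable x y')).mono
    fun _ _ hf => H.unique _ _ _ hf.1 hf.2)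

/-- Partners chosen on the pieces of a finite cover agree on overlaps because partners are unique
there, so they glue. -/
lemma exists_localRel (H : IsLocalGraph rel) (hG : IsSheaf G) (x : F.obj A) :
    ∃ y, LocalRel rel x y := by
  obtain ⟨t, ht, hspan⟩ := (Ideal.span_eq_top_iff_finite _).1 (H.exists_locally x)
  choose y hy using fun h : t => ht h.2
  obtain ⟨z, hz⟩ := hG.glue A t hspan y fun h h' B p q hpq => by
    refine H.unique (F.map (toAway A h.1 ≫ p) x) _ _ ?_ ?_
    · simpa using H.map p _ _ (hy h)
    · rw [hpq]
      simpa using H.map q _ _ (hy h')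
  refine ⟨z, top_le_iff.1 (hspan.symm.le.trans (Ideal.span_mono fun h hh => ?_))⟩
  have h1 := hy ⟨h, hh⟩
  rw [← hz ⟨h, hh⟩] at h1
  exact h1

lemma existsUnique_localRel (H : IsLocalGraph rel) (hG : IsSheaf G) (x : F.obj A) :
    ∃! y, LocalRel rel x y := by
  obtain ⟨y, hy⟩ := H.exists_localRel hG x
  exact ⟨y, hy, fun y' hy' => H.localRel_unique hG hy' hy⟩

/-- Two Zariski sheaves that are locally in bijection are isomorphic. -/
lemma nonempty_iso (H : IsLocalGraph rel) (H' : IsLocalGraph (F := G) (G := F) fun _ y x => rel x y)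
    (hF : IsSheaf F) (hG : IsSheaf G) : Nonempty (F ≅ G) := by
  choose φ hφ hφ' using fun A : CommAlgCat.{u} R => fun x : F.obj A =>
    H.existsUnique_localRel hG x
  choose ψ hψ hψ' using fun A : CommAlgCat.{u} R => fun y : G.obj A =>
    H'.existsUnique_localRel hF y
  refine ⟨NatIso.ofComponents (fun A => Equiv.toIso ⟨φ A, ψ A, fun x => ?_, fun y => ?_⟩) ?_⟩
  · exact (hψ' A _ x (hφ A x)).symm
  · exact (hφ' A _ y (hψ A y)).symm
  · intro A B f
    ext x
    -- Naturality: the base change of a local partner is a local partner, hence the unique one.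
    exact (hφ' B (F.map f x) _ (H.localRel_map f (hφ A x))).symm

end IsLocalGraph

end ZariskiLocal

open ZariskiLocal Opposite

/-! ### The functor of points of a scheme is a Zariski sheaf -/

section SchemePoints

variable {k : Type u} [Field k] {X : Over (Spec (CommRingCat.of k))}

/-- The morphism of schemes underlying a point of a `k`-scheme. -/
def pointHom {A : CommAlgCat.{u} (CommRingCat.of k)} (g : (schemePoints X).obj A) :
    Spec (CommRingCat.of A) ⟶ X.left :=
  CommaMorphism.left g

lemma pointHom_injective {A : CommAlgCat.{u} (CommRingCat.of k)} {g g' : (schemePoints X).obj A}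
    (h : pointHom g = pointHom g') : g = g' :=
  Over.OverMorphism.ext h

lemma pointHom_map {A B : CommAlgCat.{u} (CommRingCat.of k)} (f : A ⟶ B)
    (g : (schemePoints X).obj A) : pointHom ((schemePoints X).map f g) =
      Spec.map (CommRingCat.ofHom f.hom.toRingHom) ≫ pointHom g :=
  rfl

lemma pointHom_comp_hom {A : CommAlgCat.{u} (CommRingCat.of k)} (g : (schemePoints X).obj A) :
    pointHom g ≫ X.hom = Spec.map (CommRingCat.ofHom (algebraMap k A)) :=
  Over.w g

/-- The point of a `k`-scheme given by a morphism over `k`. -/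
noncomputable def pointMk {A : CommAlgCat.{u} (CommRingCat.of k)}
    (g : Spec (CommRingCat.of A) ⟶ X.left)
    (h : g ≫ X.hom = Spec.map (CommRingCat.ofHom (algebraMap k A))) : (schemePoints X).obj A :=
  Over.homMk (U := (algSpec (CommRingCat.of k)).obj (op A)) g h

/-- The basic opens Spec A_h form an open cover of Spec A, and morphisms of schemes are determined
on, and glue along, open covers. -/
lemma isSheaf_schemePoints (X : Over (Spec (CommRingCat.of k))) : IsSheaf (schemePoints X) where
  sep A x y h := by
    refine pointHom_injective ?_
    refine Scheme.Cover.hom_ext (Scheme.affineOpenCoverOfSpanRangeEqTop (R := CommRingCat.of A)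
      (fun h : {h : A | (schemePoints X).map (toAway A h) x = (schemePoints X).map (toAway A h) y}
        => (h : A)) (by rw [Subtype.range_coe]; exact h)).openCover _ _ fun i => ?_
    have hi := congrArg pointHom i.2
    rw [pointHom_map, pointHom_map] at hi
    exact hi
  glue A s hs x hx := by
    let 𝒰 := (Scheme.affineOpenCoverOfSpanRangeEqTop (R := CommRingCat.of A)
      (fun h : s => (h : A)) ((congrArg Ideal.span
        (Subtype.range_coe (s := (s : Set A)))).trans hs)).openCover
    have hcompat : ∀ i j : s, Limits.pullback.fst (𝒰.f i) (𝒰.f j) ≫ pointHom (x i) =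
        Limits.pullback.snd (𝒰.f i) (𝒰.f j) ≫ pointHom (x j) := by
      intro i j
      -- The overlap of two basic opens is the spectrum of this tensor product, so compatibility is
      -- needed for this algebra only.
      let B : CommAlgCat.{u} (CommRingCat.of k) := CommAlgCat.of _
        (Localization.Away i.1 ⊗[A] Localization.Away j.1)
      let p : awayObj A i.1 ⟶ B := CommAlgCat.ofHom
        ((Algebra.TensorProduct.includeLeft (R := A) (S := A)).restrictScalars _)
      let q : awayObj A j.1 ⟶ B := CommAlgCat.ofHom
        ((Algebra.TensorProduct.includeRight (R := A)).restrictScalars _)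
      have := congrArg pointHom (hx i j B p q (by
        ext a
        exact (AlgHom.commutes (Algebra.TensorProduct.includeLeft (R := A) (S := A)) a).trans
          (AlgHom.commutes (Algebra.TensorProduct.includeRight (R := A)) a).symm))
      rw [pointHom_map, pointHom_map] at this
      refine (cancel_epi (pullbackSpecIso A (Localization.Away i.1)
        (Localization.Away j.1)).inv).1 ?_
      have h1 := pullbackSpecIso_inv_fst A (Localization.Away i.1) (Localization.Away j.1)
      have h2 := pullbackSpecIso_inv_snd A (Localization.Away i.1) (Localization.Away j.1)
      refine ((Category.assoc _ _ _).symm.trans ?_).trans (Category.assoc _ _ _)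
      exact ((congrArg (· ≫ pointHom (x i)) h1).trans this).trans
        (congrArg (· ≫ pointHom (x j)) h2).symm
    have hglue := 𝒰.ι_glueMorphisms (fun i => pointHom (x i)) hcompat
    refine ⟨pointMk (𝒰.glueMorphisms (fun i => pointHom (x i)) hcompat) ?_, fun i => ?_⟩
    · refine 𝒰.hom_ext _ _ fun i => ?_
      rw [← Category.assoc, hglue]
      refine (pointHom_comp_hom (x i)).trans (Eq.trans ?_ (Spec.map_comp _ _))
      rfl
    · exact pointHom_injective (hglue i)

end SchemePoints

/-! ### Gluing subbundles -/

section Localize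

variable {k : Type u} [Field k] {A : Type u} [CommRing A] [Algebra k A] (B : Type u) [CommRing B]
  [Algebra k B] [Algebra A B] [IsScalarTower k A B] (W : Type u) [AddCommGroup W] [Module k W]

/-- The `A`-linear map `A ⊗ W → B ⊗ W` induced by an `A`-algebra `B`. -/
noncomputable def scalarExtension : A ⊗[k] W →ₗ[A] B ⊗[k] W :=
  TensorProduct.AlgebraTensorModule.map (Algebra.linearMap A B) LinearMap.id

variable (k A) in
lemma scalarExtension_apply (z : A ⊗[k] W) :
    scalarExtension B W z = (IsScalarTower.toAlgHom k A B).toLinearMap.rTensor W z := by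
  induction z using TensorProduct.induction_on with
  | zero => simp
  | tmul a w => simp [scalarExtension]
  | add x y hx hy => rw [map_add, map_add, hx, hy]

/-- Localization is base change, and B ⊗_A (A ⊗_k W) = B ⊗_k W. -/
lemma isLocalizedModule_scalarExtension (S : Submonoid A) [IsLocalization S B] :
    IsLocalizedModule S (scalarExtension B W : A ⊗[k] W →ₗ[A] B ⊗[k] W) := by
  have h1 : IsLocalizedModule S (TensorProduct.mk A B (A ⊗[k] W) 1) :=
    (isLocalizedModule_iff_isBaseChange S B _).2 (TensorProduct.isBaseChange A _ B)
  have h2 := IsLocalizedModule.of_linearEquiv S (TensorProduct.mk A B (A ⊗[k] W) 1)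
    ((TensorProduct.AlgebraTensorModule.cancelBaseChange k A B B W).restrictScalars A)
  convert h2 using 1
  ext w
  simp [scalarExtension]

lemma extendSubmodule_eq_localized' (S : Submonoid A) [IsLocalization S B]
    (N : Submodule A (A ⊗[k] W)) :
    haveI := isLocalizedModule_scalarExtension (k := k) B W S
    extendSubmodule (IsScalarTower.toAlgHom k A B) N =
      N.localized' B S (scalarExtension B W) := by
  rw [Submodule.localized'_eq_span, extendSubmodule]
  congr 1

lemma baseChange_rTensor {A B W W' : Type u} [CommRing A] [Algebra k A] [CommRing B]
    [Algebra k B] [AddCommGroup W] [Module k W] [AddCommGroup W'] [Module k W'] (f : A →ₐ[k] B)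
    (φ : W →ₗ[k] W') (z : A ⊗[k] W) : φ.baseChange B (f.toLinearMap.rTensor W z) =
      f.toLinearMap.rTensor W' (φ.baseChange A z) := by
  induction z using TensorProduct.induction_on with
  | zero => simp
  | tmul a w => simp
  | add x y hx hy => simp only [map_add, hx, hy]

variable {B W}

/-- In the localization z equals a fraction y/h^m with y in N; a further power of h makes this an
equality in A ⊗ W. -/
lemma exists_smul_mem_of_extend_mem (h : A) [IsLocalization.Away h B]
    {N : Submodule A (A ⊗[k] W)} {z : A ⊗[k] W}
    (hz : (IsScalarTower.toAlgHom k A B).toLinearMap.rTensor W z ∈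
      extendSubmodule (IsScalarTower.toAlgHom k A B) N) : ∃ m : ℕ, h ^ m • z ∈ N := by
  have := isLocalizedModule_scalarExtension (k := k) B W (Submonoid.powers h)
  rw [extendSubmodule_eq_localized' B W (Submonoid.powers h), ← scalarExtension_apply,
    Submodule.mem_localized'] at hz
  obtain ⟨y, hy, s, hs⟩ := hz
  rw [IsLocalizedModule.mk'_eq_iff, ← LinearMap.map_smul_of_tower,
    IsLocalizedModule.eq_iff_exists (Submonoid.powers h)] at hs
  obtain ⟨⟨_, c, rfl⟩, hc⟩ := hs
  obtain ⟨_, m, rfl⟩ := s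
  refine ⟨c + m, ?_⟩
  rw [pow_add, mul_smul]
  have := N.smul_mem (h ^ c) hy
  exact (show h ^ c • y = h ^ c • h ^ m • z from hc) ▸ this

lemma le_of_extend_le (s : Set A) (hs : Ideal.span s = ⊤) {N N' : Submodule A (A ⊗[k] W)}
    (h : ∀ a ∈ s, extendSubmodule (IsScalarTower.toAlgHom k A (Localization.Away a)) N ≤
      extendSubmodule (IsScalarTower.toAlgHom k A (Localization.Away a)) N') : N ≤ N' := by
  intro z hz
  refine Submodule.mem_of_span_eq_top_of_smul_pow_mem _ s hs _ fun a => ?_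
  exact exists_smul_mem_of_extend_mem (B := Localization.Away a.1) a.1
    (h a.1 a.2 (Submodule.subset_span ⟨z, hz, rfl⟩))

lemma eq_of_extend_eq (s : Set A) (hs : Ideal.span s = ⊤) {N N' : Submodule A (A ⊗[k] W)}
    (h : ∀ a ∈ s, extendSubmodule (IsScalarTower.toAlgHom k A (Localization.Away a)) N =
      extendSubmodule (IsScalarTower.toAlgHom k A (Localization.Away a)) N') : N = N' :=
  le_antisymm (le_of_extend_le s hs fun a ha => (h a ha).le)
    (le_of_extend_le s hs fun a ha => (h a ha).ge)

/-- Submodules of `A_h ⊗ W`, for finitely many `h` generating the unit ideal, that agree on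
overlaps come from a submodule of `A ⊗ W`. -/
lemma exists_submodule_of_compatible (s : Finset A)
    (N : ∀ h : s, Submodule (Localization.Away h.1) (Localization.Away h.1 ⊗[k] W))
    (hN : ∀ (h h' : s) (C : Type u) [CommRing C] [Algebra k C]
      (p : Localization.Away h.1 →ₐ[k] C) (q : Localization.Away h'.1 →ₐ[k] C),
      p.comp (IsScalarTower.toAlgHom k A _) = q.comp (IsScalarTower.toAlgHom k A _) →
      extendSubmodule p (N h) = extendSubmodule q (N h')) :
    ∃ N₀ : Submodule A (A ⊗[k] W), ∀ h : s,
      extendSubmodule (IsScalarTower.toAlgHom k A (Localization.Away h.1)) N₀ = N h := by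
  classical
  -- The largest candidate: all elements whose image over every piece of the cover lies in the given
  -- submodule.
  let N₀ : Submodule A (A ⊗[k] W) := ⨅ h : s,
    ((N h).restrictScalars A).comap (scalarExtension (Localization.Away h.1) W)
  have hmem : ∀ z, z ∈ N₀ ↔ ∀ h : s, (IsScalarTower.toAlgHom k A
      (Localization.Away h.1)).toLinearMap.rTensor W z ∈ N h := by
    intro z
    simp only [N₀, Submodule.mem_iInf, Submodule.mem_comap, Submodule.restrictScalars_mem,
      scalarExtension_apply]
  refine ⟨N₀, fun h => le_antisymm (Submodule.span_le.2 ?_) fun y hy => ?_⟩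
  · rintro _ ⟨z, hz, rfl⟩
    exact (hmem z).1 hz h
  · have := isLocalizedModule_scalarExtension (k := k) (Localization.Away h.1) W
      (Submonoid.powers h.1)
    obtain ⟨⟨z, _, m, rfl⟩, hz⟩ := IsLocalizedModule.surj (Submonoid.powers h.1)
      (scalarExtension (k := k) (A := A) (Localization.Away h.1) W) y
    replace hz : h.1 ^ m • y = scalarExtension (Localization.Away h.1) W z := hz
    have hzN : (IsScalarTower.toAlgHom k A
        (Localization.Away h.1)).toLinearMap.rTensor W z ∈ N h := by
      rw [← scalarExtension_apply, ← hz]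
      exact Submodule.smul_of_tower_mem _ _ hy
    -- Comparing N h with N h' over the localization of A_{h'} at h shows that a power of h moves z
    -- into N h'. As the cover is finite, one power then serves for all h'.
    have key : ∀ h' : s, ∃ m : ℕ, (IsScalarTower.toAlgHom k A
        (Localization.Away h'.1)).toLinearMap.rTensor W (h.1 ^ m • z) ∈ N h' := by
      intro h'
      let g : Localization.Away h'.1 := algebraMap A _ h.1
      let q : Localization.Away h'.1 →ₐ[k] Localization.Away g := IsScalarTower.toAlgHom k _ _
      have hu : ∀ y : Submonoid.powers h.1,
          IsUnit (q.comp (IsScalarTower.toAlgHom k A (Localization.Away h'.1)) y) := by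
        rintro ⟨_, n, rfl⟩
        rw [map_pow]
        exact (IsLocalization.Away.algebraMap_isUnit g).pow n
      let p : Localization.Away h.1 →ₐ[k] Localization.Away g :=
        IsLocalization.liftAlgHom (M := Submonoid.powers h.1)
          (f := q.comp (IsScalarTower.toAlgHom k A (Localization.Away h'.1))) hu
      have hpq : p.comp (IsScalarTower.toAlgHom k A _) = q.comp (IsScalarTower.toAlgHom k A _) := by
        ext x
        simp [p]
      have hz' : q.toLinearMap.rTensor W ((IsScalarTower.toAlgHom k A
          (Localization.Away h'.1)).toLinearMap.rTensor W z) ∈ extendSubmodule q (N h') := by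
        rw [← hN h h' _ p q hpq, ← LinearMap.comp_apply, ← LinearMap.rTensor_comp,
          ← AlgHom.comp_toLinearMap, ← hpq, AlgHom.comp_toLinearMap, LinearMap.rTensor_comp]
        exact Submodule.subset_span ⟨_, hzN, rfl⟩
      obtain ⟨m, hm⟩ := exists_smul_mem_of_extend_mem g hz'
      refine ⟨m, ?_⟩
      rw [rTensor_smul, map_pow]
      exact hm
    choose c hc using key
    have hz₀ : h.1 ^ (Finset.univ.sup c) • z ∈ N₀ := by
      rw [hmem]
      intro h'
      obtain ⟨e, he⟩ := Nat.exists_eq_add_of_le (Finset.le_sup (f := c) (Finset.mem_univ h'))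
      rw [he, pow_add, mul_comm, mul_smul, rTensor_smul]
      exact Submodule.smul_mem _ _ (hc h')
    have hu : IsUnit (algebraMap A (Localization.Away h.1) (h.1 ^ (Finset.univ.sup c + m))) := by
      rw [map_pow]
      exact (IsLocalization.Away.algebraMap_isUnit h.1).pow _
    rw [← Submodule.smul_mem_iff_of_isUnit _ hu, algebraMap_smul, pow_add, mul_smul, hz,
      ← LinearMap.map_smul, scalarExtension_apply]
    exact Submodule.subset_span ⟨_, hz₀, rfl⟩

/-- Being a subbundle is a local property. -/
lemma isSubbundle_of_extend [Module.Finite k W] (s : Set A) (hs : Ideal.span s = ⊤)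
    {N : Submodule A (A ⊗[k] W)} {e : ℕ} (h : ∀ a ∈ s, IsSubbundle
      (extendSubmodule (IsScalarTower.toAlgHom k A (Localization.Away a)) N) e) :
    IsSubbundle N e := by
  have := fun a : s => isLocalizedModule_scalarExtension (k := k) (Localization.Away a.1) W
      (Submonoid.powers a.1)
  have h' : ∀ a : s, IsSubbundle (N.localized' (Localization.Away a.1) (Submonoid.powers a.1)
      (scalarExtension (Localization.Away a.1) W)) e := fun a => by
    rw [← extendSubmodule_eq_localized']
    exact h a.1 a.2
  have hfin : Module.Finite A N := by
    refine Module.Finite.of_localizationSpan' s hs (Rₚ := fun a => Localization.Away a.1)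
      (fun a => N.toLocalized' (Localization.Away a.1) (Submonoid.powers a.1)
      (scalarExtension (Localization.Away a.1) W)) fun a => (h' a).finite
  have := Module.finitePresentation_of_projective A (A ⊗[k] W)
  have hfp : Module.FinitePresentation A ((A ⊗[k] W) ⧸ N) :=
    Module.finitePresentation_of_surjective N.mkQ N.mkQ_surjective (by
      rw [Submodule.ker_mkQ]
      exact Module.Finite.iff_fg.1 hfin)
  -- Projectivity is obtained by descending flatness, which is local, and combining it with finite
  -- presentation.
  have hflat : Module.Flat A ((A ⊗[k] W) ⧸ N) := by
    refine Module.flat_of_isLocalized_span _ _ s hs _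
      (fun a => N.toLocalizedQuotient' (Localization.Away a.1) (Submonoid.powers a.1)
      (scalarExtension (Localization.Away a.1) W)) fun a => ?_
    have := (h' a).projective_quotient
    exact (Module.flat_iff_of_isLocalization (Localization.Away a.1) (Submonoid.powers a.1) _).1
      inferInstance
  have hproj : Module.Projective A ((A ⊗[k] W) ⧸ N) :=
    Module.Flat.projective_of_finitePresentation
  have hN : Module.Projective A N := by
    obtain ⟨t, ht⟩ := Module.projective_lifting_property N.mkQ LinearMap.id N.mkQ_surjective
    refine Module.Projective.of_split N.subtype (LinearMap.codRestrict N
      (LinearMap.id - t ∘ₗ N.mkQ) fun x => ?_) ?_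
    · rw [← Submodule.Quotient.mk_eq_zero, ← Submodule.mkQ_apply, LinearMap.sub_apply, map_sub,
        sub_eq_zero]
      exact (LinearMap.congr_fun ht (N.mkQ x)).symm
    · ext x
      have h1 : N.mkQ (x : A ⊗[k] W) = 0 := (Submodule.Quotient.mk_eq_zero N).2 x.2
      change (x : A ⊗[k] W) - t (N.mkQ (x : A ⊗[k] W)) = x
      rw [h1, map_zero, sub_zero]
  refine ⟨hfin, hproj, fun p => ?_⟩
  obtain ⟨a, ha, hap⟩ : ∃ a ∈ s, a ∉ p.asIdeal := by
    by_contra! hc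
    exact p.2.ne_top (top_le_iff.1 (hs.symm.le.trans (Ideal.span_le.2 hc)))
  -- The rank at p is read off at a prime q of A_a lying over p.
  obtain ⟨q, rfl⟩ : p ∈ Set.range (PrimeSpectrum.comap (algebraMap A (Localization.Away a))) := by
    rw [PrimeSpectrum.localization_away_comap_range _ a]
    exact hap
  have := isLocalizedModule_scalarExtension (k := k) (A := A) (Localization.Away a) W
    (Submonoid.powers a)
  have := Module.rankAtStalk_isBaseChange (M := N) (Mₛ := N.localized' (Localization.Away a)
    (Submonoid.powers a) (scalarExtension (Localization.Away a) W)) (f := N.toLocalized' (Localization.Away a)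
    (Submonoid.powers a) (scalarExtension (Localization.Away a) W)) ((isLocalizedModule_iff_isBaseChange
    (Submonoid.powers a) (Localization.Away a) _).1 inferInstance) q
  rw [← this]
  exact (h' ⟨a, ha⟩).rank_eq q

end Localize

section GrassmannianSheaf

variable {k : Type u} [Field k] {ι : Type} (M : KroneckerModule k ι) [Module.Finite k M.M₁]
  [Module.Finite k M.M₂] (e₁ e₂ : ℕ)

/-- Submodules of A ⊗ W glue, and finite dimension of the two spaces makes being a subbundle a local
condition. Stability under the arrows is also local, since membership in a submodule may be tested
after multiplying by powers of elements generating the unit ideal. -/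
lemma isSheaf_grassmannianFunctor : IsSheaf (M.grassmannianFunctor e₁ e₂) where
  sep A x y h := by
    refine KroneckerModule.SubmodulePoint.ext (k := k) ?_ ?_
    · exact eq_of_extend_eq (k := k) _ h fun a ha =>
        congrArg (KroneckerModule.SubmodulePoint.N₁ (k := k)) ha
    · exact eq_of_extend_eq (k := k) _ h fun a ha =>
        congrArg (KroneckerModule.SubmodulePoint.N₂ (k := k)) ha
  glue A s hs x hx := by
    obtain ⟨N₁, h₁⟩ := exists_submodule_of_compatible (k := k) (W := M.M₁) s
      (fun h => KroneckerModule.SubmodulePoint.N₁ (k := k) (x h))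
      (fun h h' C _ _ p q hpq => congrArg (KroneckerModule.SubmodulePoint.N₁ (k := k))
        (hx h h' (CommAlgCat.of k C) (CommAlgCat.ofHom p) (CommAlgCat.ofHom q)
          (CommAlgCat.hom_ext hpq)))
    obtain ⟨N₂, h₂⟩ := exists_submodule_of_compatible (k := k) (W := M.M₂) s
      (fun h => KroneckerModule.SubmodulePoint.N₂ (k := k) (x h))
      (fun h h' C _ _ p q hpq => congrArg (KroneckerModule.SubmodulePoint.N₂ (k := k))
        (hx h h' (CommAlgCat.of k C) (CommAlgCat.ofHom p) (CommAlgCat.ofHom q)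
          (CommAlgCat.hom_ext hpq)))
    refine ⟨⟨N₁, N₂, ?_, ?_, fun a => ?_⟩, fun h =>
      KroneckerModule.SubmodulePoint.ext (k := k) (h₁ h) (h₂ h)⟩
    · exact isSubbundle_of_extend (k := k) _ hs fun a ha => by
        rw [h₁ ⟨a, ha⟩]
        exact KroneckerModule.SubmodulePoint.isSubbundle₁ (k := k) (x ⟨a, ha⟩)
    · exact isSubbundle_of_extend (k := k) _ hs fun a ha => by
        rw [h₂ ⟨a, ha⟩]
        exact KroneckerModule.SubmodulePoint.isSubbundle₂ (k := k) (x ⟨a, ha⟩)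
    · rintro _ ⟨z, hz, rfl⟩
      refine Submodule.mem_of_span_eq_top_of_smul_pow_mem _ (s : Set A) hs _ fun b => ?_
      refine exists_smul_mem_of_extend_mem (k := k) (B := Localization.Away b.1) b.1 ?_
      rw [h₂ b, ← baseChange_rTensor]
      refine KroneckerModule.SubmodulePoint.map_le (k := k) (x b) a ⟨_, ?_, rfl⟩
      rw [← h₁ b]
      exact Submodule.subset_span ⟨z, hz, rfl⟩

end GrassmannianSheaf

/-! ### Line subbundles are locally spanned by unimodular vectors -/

section Unimodular

/-- A vector is unimodular if some linear functional takes the value `1` on it. -/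
def IsUnimodular {A P : Type u} [CommRing A] [AddCommGroup P] [Module A P] (v : P) : Prop :=
  ∃ l : P →ₗ[A] A, l v = 1

section

variable {A P : Type u} [CommRing A] [AddCommGroup P] [Module A P]

/-- If l(v) = 1, then a ↦ av is injective, and x ↦ x - l(x)v kills v and so induces a section of the
quotient map. -/
lemma IsUnimodular.isSubbundle_span [Module.Projective A P] {v : P} (hv : IsUnimodular (A := A) v) :
    IsSubbundle (A ∙ v) 1 := by
  obtain ⟨l, hl⟩ := hv
  have e : A ≃ₗ[A] (A ∙ v) := LinearEquiv.ofBijective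
    ((LinearMap.toSpanSingleton A P v).codRestrict (A ∙ v) fun a =>
      Submodule.smul_mem _ _ (Submodule.mem_span_singleton_self v)) (by
    constructor
    · intro a b hab
      have : l (a • v) = l (b • v) := congrArg l (congrArg Subtype.val hab)
      simpa [hl] using this
    · rintro ⟨x, hx⟩
      obtain ⟨a, rfl⟩ := Submodule.mem_span_singleton.1 hx
      exact ⟨a, rfl⟩)
  refine ⟨Module.Finite.equiv e, ?_, fun p => ?_⟩
  · refine Module.Projective.of_split ((A ∙ v).liftQ (LinearMap.id - l.smulRight v) ?_)
      (A ∙ v).mkQ ?_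
    · rw [Submodule.span_le]
      rintro _ rfl
      simp [hl]
    · ext x
      simp only [LinearMap.comp_apply, Submodule.mkQ_apply, Submodule.liftQ_apply,
        LinearMap.sub_apply, LinearMap.id_apply, LinearMap.smulRight_apply]
      rw [Submodule.Quotient.eq]
      simpa using Submodule.smul_mem _ _ (Submodule.mem_span_singleton_self v)
  · have := p.nontrivial
    rw [← Module.rankAtStalk_eq_of_equiv e, Module.rankAtStalk_self]
    rfl

lemma IsSubbundle.exists_unimodular_of_free {N : Submodule A P} (h : IsSubbundle N 1)
    [Module.Free A N] : ∃ v : P, IsUnimodular (A := A) v ∧ N = A ∙ v := by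
  -- The zero ring has no prime at which to read the rank, but there everything is zero.
  rcases subsingleton_or_nontrivial A with hA | hA
  · have := Module.subsingleton A P
    exact ⟨0, ⟨0, Subsingleton.elim _ _⟩, Subsingleton.elim _ _⟩
  have := h.finite
  obtain ⟨r, hr⟩ := h.exists_retraction
  obtain ⟨p⟩ : Nonempty (PrimeSpectrum A) := inferInstance
  have hrank : Module.finrank A N = 1 := by
    have := h.rank_eq p
    rwa [Module.rankAtStalk_eq_finrank_of_free] at this
  let b := Module.basisUnique Unit hrank
  refine ⟨b (), ⟨b.coord () ∘ₗ r, ?_⟩, ?_⟩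
  · have : r (b () : P) = b () := LinearMap.congr_fun hr (b ())
    rw [LinearMap.comp_apply, this]
    simp
  · have hspan := b.span_eq
    rw [Set.range_unique] at hspan
    have := congrArg (Submodule.map N.subtype) hspan
    rw [Submodule.map_span, Set.image_singleton, Submodule.map_top, Submodule.range_subtype] at this
    exact this.symm

lemma IsUnimodular.isUnit_of_span_eq {v w : P} (hv : IsUnimodular (A := A) v)
    (h : (A ∙ v) = A ∙ w) : ∃ c : A, IsUnit c ∧ v = c • w := by
  obtain ⟨l, hl⟩ := hv
  obtain ⟨c, hc⟩ := Submodule.mem_span_singleton.1 (h ▸ Submodule.mem_span_singleton_self v)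
  refine ⟨c, IsUnit.of_mul_eq_one (l w) ?_, hc.symm⟩
  rw [← hl, ← hc, map_smul, smul_eq_mul]

end

variable {k : Type u} [Field k] {A B : Type u} [CommRing A] [Algebra k A] [CommRing B]
  [Algebra k B] {W : Type u} [AddCommGroup W] [Module k W]

lemma IsUnimodular.rTensor (f : A →ₐ[k] B) {v : A ⊗[k] W} (hv : IsUnimodular (A := A) v) :
    IsUnimodular (A := B) (f.toLinearMap.rTensor W v) := by
  obtain ⟨l, hl⟩ := hv
  -- The base change of l: it sends b ⊗ w to b f(l(1 ⊗ w)).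
  let l' : B ⊗[k] W →ₗ[B] B := TensorProduct.AlgebraTensorModule.lift
    ((LinearMap.lsmul B (W →ₗ[k] B)).flip (f.toLinearMap ∘ₗ l.restrictScalars k ∘ₗ
      TensorProduct.mk k A W 1))
  refine ⟨l', ?_⟩
  have key : ∀ z : A ⊗[k] W, l' (f.toLinearMap.rTensor W z) = f (l z) := by
    intro z
    induction z using TensorProduct.induction_on with
    | zero => simp
    | tmul a w =>
      have : l (a ⊗ₜ[k] w) = a * l (1 ⊗ₜ w) := by
        rw [← smul_eq_mul, ← map_smul, TensorProduct.smul_tmul', smul_eq_mul, mul_one]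
      rw [this, map_mul]
      simp [l']
    | add x y hx hy => simp only [map_add, hx, hy]
  rw [key, hl, map_one]

lemma extendSubmodule_span_singleton (f : A →ₐ[k] B) (v : A ⊗[k] W) :
    extendSubmodule f (A ∙ v) = B ∙ f.toLinearMap.rTensor W v := by
  refine le_antisymm (Submodule.span_le.2 ?_) (Submodule.span_le.2 ?_)
  · rintro _ ⟨z, hz, rfl⟩
    obtain ⟨a, rfl⟩ := Submodule.mem_span_singleton.1 hz
    rw [rTensor_smul]
    exact Submodule.smul_mem _ _ (Submodule.mem_span_singleton_self _)
  · rintro _ rfl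
    exact Submodule.subset_span ⟨v, Submodule.mem_span_singleton_self v, rfl⟩

/-- A submodule of `A ⊗ W` becomes free of rank one, generated by a unimodular vector, after base
change to `B`. -/
def IsTrivializedBy (N : Submodule A (A ⊗[k] W)) (f : A →ₐ[k] B) : Prop :=
  ∃ v : B ⊗[k] W, IsUnimodular (A := B) v ∧ extendSubmodule f N = B ∙ v

lemma IsTrivializedBy.comp {C : Type u} [CommRing C] [Algebra k C] {N : Submodule A (A ⊗[k] W)}
    {f : A →ₐ[k] B} (h : IsTrivializedBy N f) (g : B →ₐ[k] C) : IsTrivializedBy N (g.comp f) := by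
  obtain ⟨v, hv, hN⟩ := h
  refine ⟨_, hv.rTensor g, ?_⟩
  rw [extendSubmodule_comp, hN, extendSubmodule_span_singleton]

/-- A direct summand of a projective module is projective, and a finite projective module of
constant rank is free near each prime. -/
lemma IsSubbundle.exists_isTrivializedBy {N : Submodule A (A ⊗[k] W)} (h : IsSubbundle N 1)
    (p : Ideal A) [hp : p.IsPrime] : ∃ a ∉ p, IsTrivializedBy N
      (IsScalarTower.toAlgHom k A (Localization.Away a)) := by
  have hfin := h.finite
  obtain ⟨r, hr⟩ := h.exists_retraction
  have hN : Module.Projective A N := Module.Projective.of_split N.subtype r hr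
  obtain ⟨a, ha, hfree⟩ := Module.Free.away_of_finite_of_flat_of_rankAtStalk_constant N p
    fun m hm => by rw [h.rank_eq, h.rank_eq]
  refine ⟨a, ha, ?_⟩
  have h' := h.extend (IsScalarTower.toAlgHom k A (Localization.Away a))
  have := isLocalizedModule_scalarExtension (k := k) (A := A) (Localization.Away a) W
    (Submonoid.powers a)
  have hfree' : Module.Free (Localization.Away a)
      (extendSubmodule (IsScalarTower.toAlgHom k A (Localization.Away a)) N) := by
    rw [extendSubmodule_eq_localized' (Localization.Away a) W (Submonoid.powers a)]
    exact Module.Free.of_equiv ((IsLocalizedModule.iso (Submonoid.powers a)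
      (N.toLocalized' (Localization.Away a) (Submonoid.powers a)
      (scalarExtension (Localization.Away a) W))).extendScalarsOfIsLocalization
        (Submonoid.powers a) (Localization.Away a))
  exact h'.exists_unimodular_of_free

end Unimodular

/-! ### Vectors in `A ⊗ W*` as linear maps `W → A` -/

section DualTensor

variable {k : Type u} [Field k] (A : Type u) [CommRing A] [Algebra k A] (W : Type u)
  [AddCommGroup W] [Module k W] [Module.Finite k W]

/-- The `A`-linear isomorphism `A ⊗ W* ≃ Hom(W, A)`. -/
noncomputable def dualTensorEquiv : A ⊗[k] Module.Dual k W ≃ₗ[A] (W →ₗ[k] A) where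
  __ := (TensorProduct.comm k A (Module.Dual k W)).trans (dualTensorHomEquiv k W A)
  map_smul' a z := by
    induction z using TensorProduct.induction_on with
    | zero => simp
    | tmul b ξ =>
      ext w
      simp [TensorProduct.smul_tmul']
    | add x y hx hy =>
      simp only [smul_add, LinearEquiv.coe_coe, AddHom.toFun_eq_coe, LinearMap.coe_toAddHom,
        RingHom.id_apply, map_add] at *
      rw [hx, hy]

variable {A W}

@[simp]
lemma dualTensorEquiv_tmul (a : A) (ξ : Module.Dual k W) (w : W) :
    dualTensorEquiv A W (a ⊗ₜ ξ) w = ξ w • a := by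
  change dualTensorHom k W A (ξ ⊗ₜ a) w = _
  simp

lemma dualTensorEquiv_rTensor {B : Type u} [CommRing B] [Algebra k B] (f : A →ₐ[k] B)
    (z : A ⊗[k] Module.Dual k W) (w : W) :
    dualTensorEquiv B W (f.toLinearMap.rTensor _ z) w = f (dualTensorEquiv A W z w) := by
  induction z using TensorProduct.induction_on with
  | zero => simp
  | tmul b ξ => simp
  | add x y hx hy => simp only [map_add, LinearMap.add_apply, hx, hy]

/-- For functionals with values in A, a transposed map is precomposition. This makes the arrows of
the dual module computable on forms. -/
lemma dualTensorEquiv_baseChange {W' : Type u} [AddCommGroup W'] [Module k W'] [Module.Finite k W']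
    (g : W →ₗ[k] W') (z : A ⊗[k] Module.Dual k W') (w : W) :
    dualTensorEquiv A W (g.dualMap.baseChange A z) w = dualTensorEquiv A W' z (g w) := by
  induction z using TensorProduct.induction_on with
  | zero => simp
  | tmul b ξ => simp
  | add x y hx hy => simp only [map_add, LinearMap.add_apply, hx, hy]

/-- The functional on `A ⊗ W*` given by evaluation at `w`. -/
noncomputable def evalAt (w : W) : A ⊗[k] Module.Dual k W →ₗ[A] A :=
  LinearMap.applyₗ' A w ∘ₗ (dualTensorEquiv A W).toLinearMap

lemma isUnimodular_of_isUnit {v : A ⊗[k] Module.Dual k W} (w : W)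
    (h : IsUnit (dualTensorEquiv A W v w)) : IsUnimodular (A := A) v := by
  obtain ⟨u, hu⟩ := h
  refine ⟨(↑u⁻¹ : A) • evalAt w, ?_⟩
  change (↑u⁻¹ : A) * dualTensorEquiv A W v w = 1
  rw [← hu, Units.inv_mul]

/-- The coordinates of a unimodular vector generate the unit ideal. -/
lemma IsUnimodular.eq_top_of_forall_mem {v : A ⊗[k] Module.Dual k W}
    (hv : IsUnimodular (A := A) v) (I : Ideal A) (h : ∀ w, dualTensorEquiv A W v w ∈ I) :
    I = ⊤ := by
  obtain ⟨l, hl⟩ := hv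
  rw [Ideal.eq_top_iff_one, ← hl]
  let b := Module.finBasis k W
  -- Expansion in a dual basis: any functional applied to v, in particular l with l(v) = 1, is a
  -- combination of the values of v.
  have : v = ∑ i, dualTensorEquiv A W v (b i) ⊗ₜ[k] b.coord i := by
    apply (dualTensorEquiv A W).injective
    refine b.ext fun j => ?_
    rw [map_sum, LinearMap.sum_apply, Finset.sum_eq_single j]
    · simp
    · intro i _ hij
      simp [Finsupp.single_eq_of_ne hij]
    · simp
  rw [this, map_sum]
  refine Ideal.sum_mem _ fun i _ => ?_
  have h1 : (dualTensorEquiv A W v (b i) ⊗ₜ[k] b.coord i : A ⊗[k] Module.Dual k W) =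
    dualTensorEquiv A W v (b i) • (1 ⊗ₜ b.coord i) := by simp [TensorProduct.smul_tmul']
  rw [h1, map_smul]
  exact I.mul_mem_right _ (h _)

end DualTensor

/-! ### Homogeneous polynomials -/

section Homogeneous

open MvPolynomial

/-- Every monomial of positive degree is divisible by a variable. -/
lemma MvPolynomial.IsHomogeneous.induction_X_mul {σ R : Type*} [CommSemiring R] {m : ℕ}
    {P : MvPolynomial σ R → Prop} (zero : P 0) (add : ∀ p q, P p → P q → P (p + q))
    (X_mul : ∀ c q, q.IsHomogeneous m → P (X c * q)) {p : MvPolynomial σ R}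
    (hp : p.IsHomogeneous (m + 1)) : P p := by
  classical
  rw [p.as_sum]
  refine Finset.sum_induction _ P add zero fun s hs => ?_
  have hdeg : s.degree = m + 1 := by
    rw [Finsupp.degree_eq_weight_one]
    exact hp (mem_support_iff.1 hs)
  obtain ⟨c, hc⟩ : ∃ c, s c ≠ 0 := by
    by_contra! hc
    have : s = 0 := Finsupp.ext hc
    simp [this] at hdeg
  have hle : Finsupp.single c 1 ≤ s := by
    simpa [Finsupp.single_le_iff] using Nat.one_le_iff_ne_zero.2 hc
  have hs' : Finsupp.single c 1 + (s - Finsupp.single c 1) = s := add_tsub_cancel_of_le hle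
  have : monomial s (coeff s p) = X c * monomial (s - Finsupp.single c 1) (coeff s p) := by
    rw [X, monomial_mul, hs', one_mul]
  rw [this]
  refine X_mul _ _ (isHomogeneous_monomial _ ?_)
  rw [← hs', map_add, Finsupp.degree_single] at hdeg
  omega

lemma MvPolynomial.IsHomogeneous.of_eq {σ R : Type*} [CommSemiring R] {p : MvPolynomial σ R}
    {i j : ℕ} (hp : p.IsHomogeneous i) (h : i = j) : p.IsHomogeneous j :=
  h ▸ hp

lemma MvPolynomial.IsHomogeneous.aeval_smul {σ R A : Type*} [CommSemiring R] [CommSemiring A]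
    [Algebra R A] {m : ℕ} {p : MvPolynomial σ R} (hp : p.IsHomogeneous m) (u : A) (x : σ → A) :
    MvPolynomial.aeval (fun c => u * x c) p = u ^ m * MvPolynomial.aeval x p := by
  induction m generalizing p with
  | zero =>
    rw [totalDegree_eq_zero_iff_eq_C.1 ((totalDegree_zero_iff_isHomogeneous _).2 hp)]
    simp
  | succ m ih =>
    refine hp.induction_X_mul (P := fun p => MvPolynomial.aeval (fun c => u * x c) p =
      u ^ (m + 1) * MvPolynomial.aeval x p)
      (by simp) (fun p q hp hq => by simp only [map_add, hp, hq, mul_add]) fun c q hq => ?_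
    simp only [map_mul, aeval_X, ih hq]
    ring

variable {σ k A : Type*} [Field k] [CommRing A] [Algebra k A] {m : ℕ}
  {φ ψ : MvPolynomial σ k →ₗ[k] A} {x : σ → A}

/-- If `φ (X_c q) = x_c ψ q` for all forms `q` of degree `m`, then `ψ` is proportional to the
evaluation at `x`. -/
lemma pow_mul_apply_eq_of_X_mul
    (h : ∀ c q, q.IsHomogeneous m → φ (X c * q) = x c * ψ q) (a : σ) {j i : ℕ} (hij : i + j = m)
    {p : MvPolynomial σ k} (hp : p.IsHomogeneous j) :
    x a ^ j * ψ (X a ^ i * p) = aeval x p * ψ (X a ^ m) := by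
  induction j generalizing p i with
  | zero =>
    rw [totalDegree_eq_zero_iff_eq_C.1 ((totalDegree_zero_iff_isHomogeneous _).2 hp), ← hij,
      mul_comm (X a ^ i), ← smul_eq_C_mul, map_smul, aeval_C, ← Algebra.smul_def]
    simp
  | succ j ih =>
    refine hp.induction_X_mul (P := fun p => x a ^ (j + 1) * ψ (X a ^ i * p) =
      aeval x p * ψ (X a ^ m)) (by simp) (fun p q hp hq => by
        simp only [mul_add, map_add, hp, hq, add_mul]) fun c q hq => ?_
    -- Both sides equal φ(X_a^(i+1) X_c q): this is the exchange of X_c for X_a.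
    have h1 : x a * ψ (X a ^ i * (X c * q)) = x c * ψ (X a ^ (i + 1) * q) := by
      rw [← h, ← h]
      · congr 1
        ring
      · exact ((isHomogeneous_X_pow a (i + 1)).mul hq).of_eq (by omega)
      · exact ((isHomogeneous_X_pow a i).mul ((isHomogeneous_X k c).mul hq)).of_eq
          (by omega)
    calc x a ^ (j + 1) * ψ (X a ^ i * (X c * q))
        = x a ^ j * (x a * ψ (X a ^ i * (X c * q))) := by ring
      _ = x c * (x a ^ j * ψ (X a ^ (i + 1) * q)) := by rw [h1]; ring
      _ = aeval x (X c * q) * ψ (X a ^ m) := by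
        rw [ih (by omega) hq, map_mul, aeval_X, mul_assoc]

/-- On products X_c q the claim reduces to the proportionality of ψ, because φ(X_c q) = x_c ψ(q) and
φ(X_a^(m+1)) = x_a ψ(X_a^m). -/
lemma pow_mul_apply_eq_of_X_mul'
    (h : ∀ c q, q.IsHomogeneous m → φ (X c * q) = x c * ψ q) (a : σ)
    {p : MvPolynomial σ k} (hp : p.IsHomogeneous (m + 1)) :
    x a ^ (m + 1) * φ p = aeval x p * φ (X a ^ (m + 1)) := by
  refine hp.induction_X_mul (P := fun p => x a ^ (m + 1) * φ p =
      aeval x p * φ (X a ^ (m + 1))) (by simp) (fun p q hp hq => by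
        simp only [mul_add, map_add, hp, hq, add_mul]) fun c q hq => ?_
  have h1 := pow_mul_apply_eq_of_X_mul h a (zero_add m) hq
  rw [pow_zero, one_mul] at h1
  rw [h c q hq, pow_succ' (X a), h a _ (isHomogeneous_X_pow a m), map_mul, aeval_X]
  linear_combination x a * x c * h1

end Homogeneous

/-! ### Points of the quiver grassmannian from tuples -/

section TuplePoint

open MvPolynomial

variable {n : ℕ} {k : Type u} [Field k] (I : Ideal (MvPolynomial (Fin (n + 1)) k))

instance finite_polyGrading (m : ℕ) : Module.Finite k (polyGrading n k m) :=
  Module.Finite.iff_fg.2 (homogeneousSubmodule_fg _ _ m)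

/-- The component `S^m V / I_m` of the homogeneous coordinate ring. -/
abbrev quotientPiece (m : ℕ) : Type u := polyGrading n k m ⧸ idealPiece I m

/-- The class in `S^m V / I_m` of the component of degree `m` of a polynomial. -/
noncomputable def toPiece (m : ℕ) : MvPolynomial (Fin (n + 1)) k →ₗ[k] quotientPiece I m :=
  (idealPiece I m).mkQ ∘ₗ (homogeneousComponent m).codRestrict (polyGrading n k m)
    (homogeneousComponent_mem m)

lemma toPiece_of_isHomogeneous {m : ℕ} {p : MvPolynomial (Fin (n + 1)) k} (hp : p.IsHomogeneous m) :
    toPiece I m p = (idealPiece I m).mkQ ⟨p, hp⟩ := by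
  rw [toPiece, LinearMap.comp_apply]
  congr 1
  exact Subtype.ext (homogeneousComponent_eq_self hp)

lemma exists_toPiece_eq {m : ℕ} (w : quotientPiece I m) :
    ∃ p : MvPolynomial (Fin (n + 1)) k, p.IsHomogeneous m ∧ toPiece I m p = w := by
  obtain ⟨⟨p, hp⟩, rfl⟩ := (idealPiece I m).mkQ_surjective w
  exact ⟨p, hp, toPiece_of_isHomogeneous I hp⟩

lemma toPiece_eq_zero {m : ℕ} {p : MvPolynomial (Fin (n + 1)) k} (hp : p.IsHomogeneous m)
    (hpI : p ∈ I) : toPiece I m p = 0 := by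
  rw [toPiece_of_isHomogeneous I hp]
  exact (Submodule.Quotient.mk_eq_zero _).2 hpI

lemma arrow_toPiece {d : ℕ} (hd : 1 ≤ d) (c : Fin (n + 1)) {q : MvPolynomial (Fin (n + 1)) k}
    (hq : q.IsHomogeneous (d - 1)) :
    (multiplicationModule I d hd).arrow c (toPiece I (d - 1) q) = toPiece I d (X c * q) := by
  rw [toPiece_of_isHomogeneous I hq, toPiece_of_isHomogeneous I
    (((isHomogeneous_X k c).mul hq).of_eq (Nat.add_sub_cancel' hd))]
  rfl

variable {A B : Type u} [CommRing A] [Algebra k A] [CommRing B] [Algebra k B]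

/-- Evaluation of forms of degree `m` at a zero `x` of the ideal `I`. -/
noncomputable def evalPiece (x : Fin (n + 1) → A) (hx : I ≤ RingHom.ker (aeval (R := k) x)) (m : ℕ) :
    quotientPiece I m →ₗ[k] A :=
  (idealPiece I m).liftQ ((aeval x).toLinearMap ∘ₗ (polyGrading n k m).subtype)
    fun _ hp => hx hp

variable {I}

lemma evalPiece_toPiece (x : Fin (n + 1) → A) (hx : I ≤ RingHom.ker (aeval (R := k) x)) {m : ℕ}
    {p : MvPolynomial (Fin (n + 1)) k} (hp : p.IsHomogeneous m) :
    evalPiece I x hx m (toPiece I m p) = aeval x p := by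
  rw [toPiece_of_isHomogeneous I hp]
  rfl

variable (I) in
/-- The vector of `A ⊗ (S^m V / I_m)*` given by evaluation at `x`. -/
noncomputable def evalVector (x : Fin (n + 1) → A) (hx : I ≤ RingHom.ker (aeval (R := k) x))
    (m : ℕ) : A ⊗[k] Module.Dual k (quotientPiece I m) :=
  (dualTensorEquiv A (quotientPiece I m)).symm (evalPiece I x hx m)

lemma dualTensorEquiv_evalVector (x : Fin (n + 1) → A)
    (hx : I ≤ RingHom.ker (aeval (R := k) x)) {m : ℕ} {p : MvPolynomial (Fin (n + 1)) k}
    (hp : p.IsHomogeneous m) :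
    dualTensorEquiv A _ (evalVector I x hx m) (toPiece I m p) = aeval x p := by
  rw [evalVector, LinearEquiv.apply_symm_apply, evalPiece_toPiece x hx hp]

lemma dualTensor_ext {m : ℕ} {v w : A ⊗[k] Module.Dual k (quotientPiece I m)}
    (h : ∀ p : MvPolynomial (Fin (n + 1)) k, p.IsHomogeneous m →
      dualTensorEquiv A _ v (toPiece I m p) = dualTensorEquiv A _ w (toPiece I m p)) : v = w := by
  refine (dualTensorEquiv A _).injective (LinearMap.ext fun z => ?_)
  obtain ⟨p, hp, rfl⟩ := exists_toPiece_eq I z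
  exact h p hp

/-- The value at X_a^m is the unit x_a^m. -/
lemma isUnimodular_evalVector (x : Fin (n + 1) → A) (hx : I ≤ RingHom.ker (aeval (R := k) x))
    {a : Fin (n + 1)} (ha : IsUnit (x a)) (m : ℕ) :
    IsUnimodular (A := A) (evalVector I x hx m) := by
  refine isUnimodular_of_isUnit (toPiece I m (X a ^ m)) ?_
  rw [dualTensorEquiv_evalVector x hx (isHomogeneous_X_pow a m), map_pow, aeval_X]
  exact ha.pow m

lemma le_ker_aeval_comp {x : Fin (n + 1) → A} (hx : I ≤ RingHom.ker (aeval (R := k) x))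
    (f : A →ₐ[k] B) : I ≤ RingHom.ker (aeval (R := k) fun c => f (x c)) := fun p hp => by
  have := (congrArg f ((RingHom.mem_ker).1 (hx hp))).trans (map_zero f)
  rw [RingHom.mem_ker, ← this, ← AlgHom.comp_apply, comp_aeval]

lemma rTensor_evalVector (f : A →ₐ[k] B) (x : Fin (n + 1) → A)
    (hx : I ≤ RingHom.ker (aeval (R := k) x)) (m : ℕ) :
    f.toLinearMap.rTensor _ (evalVector I x hx m) =
      evalVector I (fun c => f (x c)) (le_ker_aeval_comp hx f) m := by
  refine dualTensor_ext fun p hp => ?_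
  rw [dualTensorEquiv_rTensor, dualTensorEquiv_evalVector x hx hp, dualTensorEquiv_evalVector _ _ hp,
    ← AlgHom.comp_apply, comp_aeval]

lemma evalVector_smul {x y : Fin (n + 1) → A} (hx : I ≤ RingHom.ker (aeval (R := k) x))
    (hy : I ≤ RingHom.ker (aeval (R := k) y)) {u : A} (h : ∀ c, x c = u * y c) (m : ℕ) :
    evalVector I x hx m = u ^ m • evalVector I y hy m := by
  refine dualTensor_ext fun p hp => ?_
  rw [map_smul, LinearMap.smul_apply, dualTensorEquiv_evalVector x hx hp,
    dualTensorEquiv_evalVector y hy hp, smul_eq_mul, ← hp.aeval_smul, funext h]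

lemma baseChange_evalVector {d : ℕ} (hd : 1 ≤ d) (x : Fin (n + 1) → A)
    (hx : I ≤ RingHom.ker (aeval (R := k) x)) (c : Fin (n + 1))
    {g : quotientPiece I (d - 1) →ₗ[k] quotientPiece I d}
    (hg : g = (multiplicationModule I d hd).arrow c) :
    g.dualMap.baseChange A (evalVector I x hx d) = x c • evalVector I x hx (d - 1) := by
  refine dualTensor_ext fun q hq => ?_
  have h1 : g (toPiece I (d - 1) q) = toPiece I d (X c * q) := by
    rw [hg]
    exact arrow_toPiece I hd c hq
  rw [dualTensorEquiv_baseChange, map_smul, LinearMap.smul_apply, dualTensorEquiv_evalVector x hx hq,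
    h1, dualTensorEquiv_evalVector x hx
      (((isHomogeneous_X k c).mul hq).of_eq (Nat.add_sub_cancel' hd)), map_mul, aeval_X,
    smul_eq_mul]

lemma map_span_singleton_le {P P' : Type u} [AddCommGroup P] [Module A P] [AddCommGroup P']
    [Module A P'] {φ : P →ₗ[A] P'} {v : P} {w : P'} {a : A} (h : φ v = a • w) :
    (A ∙ v).map φ ≤ A ∙ w := by
  rw [Submodule.map_span, Set.image_singleton, Submodule.span_singleton_le_iff_mem, h]
  exact Submodule.smul_mem _ _ (Submodule.mem_span_singleton_self w)

variable (I) in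
/-- The submodules spanned by the evaluations at `x`. -/
noncomputable def tuplePoint {d : ℕ} (hd : 1 ≤ d) (x : Fin (n + 1) → A)
    (hx : I ≤ RingHom.ker (aeval (R := k) x)) (hu : ∃ a, IsUnit (x a)) :
    (multiplicationModule I d hd).dual.SubmodulePoint 1 1 A where
  N₁ := A ∙ evalVector I x hx d
  N₂ := A ∙ evalVector I x hx (d - 1)
  isSubbundle₁ := (isUnimodular_evalVector x hx hu.choose_spec d).isSubbundle_span
  isSubbundle₂ := (isUnimodular_evalVector x hx hu.choose_spec (d - 1)).isSubbundle_span
  map_le c := map_span_singleton_le (baseChange_evalVector hd x hx c rfl)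

end TuplePoint

/-! ### Tuples up to units, and recovering a tuple from a pair of submodules -/

section TupleLocal

open MvPolynomial

variable {n : ℕ} {k : Type u} [Field k] {I : Ideal (MvPolynomial (Fin (n + 1)) k)}
  {A B : Type u} [CommRing A] [Algebra k A] [CommRing B] [Algebra k B]

lemma extendSubmodule_span_evalVector (x : Fin (n + 1) → A)
    (hx : I ≤ RingHom.ker (aeval (R := k) x)) (f : A →ₐ[k] B) (m : ℕ) :
    extendSubmodule f (A ∙ evalVector I x hx m) =
      B ∙ evalVector I (fun c => f (x c)) (le_ker_aeval_comp hx f) m := by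
  rw [extendSubmodule_span_singleton, rTensor_evalVector]

lemma extend_tuplePoint {d : ℕ} (hd : 1 ≤ d) (x : Fin (n + 1) → A)
    (hx : I ≤ RingHom.ker (aeval (R := k) x)) (hu : ∃ a, IsUnit (x a)) (f : A →ₐ[k] B) :
    (tuplePoint I hd x hx hu).extend f = tuplePoint I hd (fun c => f (x c))
      (le_ker_aeval_comp hx f) (hu.imp fun _ h => h.map f) := by
  exact KroneckerModule.SubmodulePoint.ext (extendSubmodule_span_evalVector x hx f d)
    (extendSubmodule_span_evalVector x hx f (d - 1))

lemma span_evalVector_eq {x y : Fin (n + 1) → A} (hx : I ≤ RingHom.ker (aeval (R := k) x))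
    (hy : I ≤ RingHom.ker (aeval (R := k) y)) {u : A} (hu : IsUnit u) (h : ∀ c, x c = u * y c)
    (m : ℕ) : (A ∙ evalVector I x hx m) = A ∙ evalVector I y hy m := by
  rw [evalVector_smul hx hy h, Submodule.span_singleton_smul_eq (hu.pow m)]

lemma tuplePoint_eq {d : ℕ} (hd : 1 ≤ d) {x y : Fin (n + 1) → A}
    (hx : I ≤ RingHom.ker (aeval (R := k) x)) (hy : I ≤ RingHom.ker (aeval (R := k) y))
    (hxu : ∃ a, IsUnit (x a)) (hyu : ∃ a, IsUnit (y a)) {u : A} (hu : IsUnit u)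
    (h : ∀ c, x c = u * y c) : tuplePoint I hd x hx hxu = tuplePoint I hd y hy hyu :=
  KroneckerModule.SubmodulePoint.ext (span_evalVector_eq hx hy hu h d)
    (span_evalVector_eq hx hy hu h (d - 1))

/-- Equal lines give ev_x = s ev_y in degree d. Testing on X_c X_a^(d-1) gives x_a^(d-1) x_c = s
y_a^(d-1) y_c, so u = s y_a^(d-1) / x_a^(d-1); the case c = a shows that u is a unit. -/
lemma exists_unit_of_tuplePoint_eq {d : ℕ} (hd : 1 ≤ d) {x y : Fin (n + 1) → A}
    (hx : I ≤ RingHom.ker (aeval (R := k) x)) (hy : I ≤ RingHom.ker (aeval (R := k) y))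
    (hxu : ∃ a, IsUnit (x a)) (hyu : ∃ a, IsUnit (y a))
    (h : tuplePoint I hd x hx hxu = tuplePoint I hd y hy hyu) :
    ∃ u : A, IsUnit u ∧ ∀ c, x c = u * y c := by
  obtain ⟨a, ha⟩ := hxu
  have h1 : (A ∙ evalVector I x hx d) = A ∙ evalVector I y hy d :=
    congrArg KroneckerModule.SubmodulePoint.N₁ h
  obtain ⟨s, hs, hv⟩ := (isUnimodular_evalVector x hx ha d).isUnit_of_span_eq h1
  have key : ∀ c, x a ^ (d - 1) * x c = s * y a ^ (d - 1) * y c := by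
    intro c
    have hp : (X c * X a ^ (d - 1) : MvPolynomial (Fin (n + 1)) k).IsHomogeneous d :=
      ((isHomogeneous_X k c).mul (isHomogeneous_X_pow a (d - 1))).of_eq (Nat.add_sub_cancel' hd)
    have h2 := congrArg (fun v => dualTensorEquiv A _ v (toPiece I d (X c * X a ^ (d - 1)))) hv
    simp only [map_smul, LinearMap.smul_apply, dualTensorEquiv_evalVector _ _ hp, map_mul, map_pow,
      aeval_X, smul_eq_mul] at h2
    linear_combination h2
  obtain ⟨t, ht⟩ := ha.pow (d - 1)
  refine ⟨(↑t⁻¹ : A) * (s * y a ^ (d - 1)), t⁻¹.isUnit.mul ?_, fun c => ?_⟩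
  · refine isUnit_of_mul_isUnit_left (y := y a) ?_
    rw [← key]
    exact (ha.pow _).mul ha
  · rw [mul_assoc, ← key, ← ht, Units.inv_mul_cancel_left]

/-- Since t is a unit, all values of v lie in the ideal (s), and the values of a unimodular vector
generate the unit ideal. -/
lemma isUnit_of_proportional {m : ℕ} {v : A ⊗[k] Module.Dual k (quotientPiece I m)}
    (hv : IsUnimodular (A := A) v) {x : Fin (n + 1) → A} {s t : A} (ht : IsUnit t)
    (h : ∀ p : MvPolynomial (Fin (n + 1)) k, p.IsHomogeneous m →
      t * dualTensorEquiv A _ v (toPiece I m p) = aeval x p * s) : IsUnit s := by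
  rw [← Ideal.span_singleton_eq_top]
  refine hv.eq_top_of_forall_mem _ fun w => ?_
  obtain ⟨p, hp, rfl⟩ := exists_toPiece_eq I w
  rw [Ideal.mem_span_singleton, ← ht.dvd_mul_left, h p hp]
  exact Dvd.intro_left _ rfl

lemma span_eq_of_proportional {m : ℕ} {v : A ⊗[k] Module.Dual k (quotientPiece I m)}
    {x : Fin (n + 1) → A} (hx : I ≤ RingHom.ker (aeval (R := k) x)) {s t : A} (hs : IsUnit s)
    (ht : IsUnit t) (h : ∀ p : MvPolynomial (Fin (n + 1)) k, p.IsHomogeneous m →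
      t * dualTensorEquiv A _ v (toPiece I m p) = aeval x p * s) :
    (A ∙ v) = A ∙ evalVector I x hx m := by
  have : t • v = s • evalVector I x hx m := dualTensor_ext fun p hp => by
    rw [map_smul, map_smul, LinearMap.smul_apply, LinearMap.smul_apply,
      dualTensorEquiv_evalVector x hx hp, smul_eq_mul, smul_eq_mul, h p hp, mul_comm]
  rw [← Submodule.span_singleton_smul_eq ht, this, Submodule.span_singleton_smul_eq hs]

/-- The scalars by which the arrows act on a free point of the quiver grassmannian. -/
lemma exists_scalars_of_span {d : ℕ} (hd : 1 ≤ d)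
    (N : (multiplicationModule I d hd).dual.SubmodulePoint 1 1 A)
    {v : A ⊗[k] Module.Dual k (quotientPiece I d)}
    {w : A ⊗[k] Module.Dual k (quotientPiece I (d - 1))} (hv : IsUnimodular (A := A) v)
    (h₁ : N.N₁ = A ∙ v) (h₂ : N.N₂ = A ∙ w) :
    ∃ x : Fin (n + 1) → A, Ideal.span (Set.range x) = ⊤ ∧
      ∀ c (q : MvPolynomial (Fin (n + 1)) k), q.IsHomogeneous (d - 1) →
        dualTensorEquiv A _ v (toPiece I d (X c * q)) =
          x c * dualTensorEquiv A _ w (toPiece I (d - 1) q) := by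
  have hmem : ∀ c, ∃ b : A, b • w = LinearMap.baseChange A
      (((multiplicationModule I d hd).arrow c).dualMap) v := fun c => by
    refine Submodule.mem_span_singleton.1 ?_
    have : v ∈ N.N₁ := by
      rw [h₁]
      exact Submodule.mem_span_singleton_self v
    have h3 := N.map_le c ⟨v, this, rfl⟩
    rw [h₂] at h3
    exact h3
  choose x hx using hmem
  have key : ∀ c (q : MvPolynomial (Fin (n + 1)) k), q.IsHomogeneous (d - 1) →
      dualTensorEquiv A _ v (toPiece I d (X c * q)) =
        x c * dualTensorEquiv A _ w (toPiece I (d - 1) q) := fun c q hq => by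
    have h4 := congrArg (fun z => dualTensorEquiv A (quotientPiece I (d - 1)) z
      (toPiece I (d - 1) q)) (hx c)
    simp only [map_smul, LinearMap.smul_apply, smul_eq_mul] at h4
    rw [h4, ← arrow_toPiece I hd c hq]
    obtain ⟨g, hg⟩ : ∃ g : quotientPiece I (d - 1) →ₗ[k] quotientPiece I d,
      g = (multiplicationModule I d hd).arrow c := ⟨_, rfl⟩
    have h5 := dualTensorEquiv_baseChange g v (toPiece I (d - 1) q)
    subst hg
    exact h5.symm
  -- As d ≥ 1, forms of degree d are sums of products X_c q, so all values of v lie in the ideal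
  -- generated by the x_c.
  refine ⟨x, hv.eq_top_of_forall_mem _ fun z => ?_, key⟩
  obtain ⟨p, hp, rfl⟩ := exists_toPiece_eq I z
  refine (hp.of_eq (Nat.sub_add_cancel hd).symm).induction_X_mul
    (P := fun p => dualTensorEquiv A _ v (toPiece I d p) ∈ Ideal.span (Set.range x))
    (by simp) (fun p q hp hq => by simpa only [map_add] using add_mem hp hq) fun c q hq => ?_
  rw [key c q hq]
  exact Ideal.mul_mem_right _ _ (Ideal.subset_span ⟨c, rfl⟩)

/-- The converse construction: once some x_a is a unit, the exchange relations force v and w to be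
unit multiples of evaluation at x. -/
lemma exists_tuplePoint_eq {r d : ℕ} (hd : 1 ≤ d) {f : Fin r → MvPolynomial (Fin (n + 1)) k}
    (hI : I = Ideal.span (Set.range f)) {deg : Fin r → ℕ} (hf : ∀ j, (f j).IsHomogeneous (deg j))
    (hdeg : ∀ j, deg j ≤ d)
    (N : (multiplicationModule I d hd).dual.SubmodulePoint 1 1 A)
    {v : A ⊗[k] Module.Dual k (quotientPiece I d)}
    {w : A ⊗[k] Module.Dual k (quotientPiece I (d - 1))}
    (hv : IsUnimodular (A := A) v) (hw : IsUnimodular (A := A) w)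
    (h₁ : N.N₁ = A ∙ v) (h₂ : N.N₂ = A ∙ w) {x : Fin (n + 1) → A}
    (h : ∀ c (q : MvPolynomial (Fin (n + 1)) k), q.IsHomogeneous (d - 1) →
        dualTensorEquiv A _ v (toPiece _ d (X c * q)) =
          x c * dualTensorEquiv A _ w (toPiece _ (d - 1) q)) {a : Fin (n + 1)}
    (ha : IsUnit (x a)) :
    ∃ hx : I ≤ RingHom.ker (aeval (R := k) x),
      N = tuplePoint _ hd x hx ⟨a, ha⟩ := by
  have hφ : ∀ p : MvPolynomial (Fin (n + 1)) k, p.IsHomogeneous d →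
      x a ^ d * dualTensorEquiv A _ v (toPiece I d p) =
        aeval x p * dualTensorEquiv A _ v (toPiece I d (X a ^ d)) := fun p hp => by
    have := pow_mul_apply_eq_of_X_mul' (φ := dualTensorEquiv A _ v ∘ₗ toPiece I d)
      (ψ := dualTensorEquiv A _ w ∘ₗ toPiece I (d - 1)) h a
      (hp.of_eq (Nat.sub_add_cancel hd).symm)
    rwa [Nat.sub_add_cancel hd] at this
  have hψ : ∀ p : MvPolynomial (Fin (n + 1)) k, p.IsHomogeneous (d - 1) →
      x a ^ (d - 1) * dualTensorEquiv A _ w (toPiece I (d - 1) p) =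
        aeval x p * dualTensorEquiv A _ w (toPiece I (d - 1) (X a ^ (d - 1))) := fun p hp => by
    have := pow_mul_apply_eq_of_X_mul (φ := dualTensorEquiv A _ v ∘ₗ toPiece I d)
      (ψ := dualTensorEquiv A _ w ∘ₗ toPiece I (d - 1)) h a (zero_add (d - 1)) hp
    rwa [pow_zero, one_mul] at this
  have hvu := isUnit_of_proportional hv (ha.pow d) hφ
  have hwu := isUnit_of_proportional hw (ha.pow (d - 1)) hψ
  have hx : I ≤ RingHom.ker (aeval (R := k) x) := by
    conv_lhs => rw [hI]
    rw [Ideal.span_le]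
    rintro _ ⟨j, rfl⟩
    -- Multiplying by a power of X_a lifts f_j to degree d, where v detects it; this is the role of
    -- d ≥ deg f_j.
    have hp : (X a ^ (d - deg j) * f j).IsHomogeneous d :=
      ((isHomogeneous_X_pow a (d - deg j)).mul (hf j)).of_eq (Nat.sub_add_cancel (hdeg j))
    have h3 := hφ _ hp
    rw [toPiece_eq_zero I hp (I.mul_mem_left _ (by
      rw [hI]
      exact Ideal.subset_span ⟨j, rfl⟩)), map_zero, mul_zero,
      eq_comm, hvu.mul_left_eq_zero, map_mul, map_pow, aeval_X,
      (ha.pow (d - deg j)).mul_right_eq_zero] at h3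
    exact h3
  exact ⟨hx, KroneckerModule.SubmodulePoint.ext
    (h₁.trans (span_eq_of_proportional hx hvu (ha.pow d) hφ))
    (h₂.trans (span_eq_of_proportional hx hwu (ha.pow (d - 1)) hψ))⟩

/-- Locally, every point of the quiver grassmannian comes from a tuple. -/
lemma locally_exists_tuplePoint {r d : ℕ} (hd : 1 ≤ d) {f : Fin r → MvPolynomial (Fin (n + 1)) k}
    (hI : I = Ideal.span (Set.range f)) {deg : Fin r → ℕ} (hf : ∀ j, (f j).IsHomogeneous (deg j))
    (hdeg : ∀ j, deg j ≤ d)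
    {A : CommAlgCat.{u} (CommRingCat.of k)}
    (N : (multiplicationModule I d hd).dual.SubmodulePoint (k := k) 1 1 A) :
    Locally A fun B g => ∃ (x : Fin (n + 1) → B)
      (hx : I ≤ RingHom.ker (aeval (R := k) x)) (hu : ∃ a, IsUnit (x a)),
      N.extend (k := k) g.hom = tuplePoint (k := k) _ hd x hx hu := by
  have hstable : Stable fun (B : CommAlgCat.{u} (CommRingCat.of k)) (g : A ⟶ B) =>
      ∃ (x : Fin (n + 1) → B) (hx : I ≤ RingHom.ker (aeval (R := k) x)) (hu : ∃ a, IsUnit (x a)),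
      N.extend (k := k) g.hom = tuplePoint (k := k) I hd x hx hu := by
    rintro B C g g' ⟨x, hx, hu, h⟩
    refine ⟨_, _, _, Eq.trans ?_ ((congrArg (fun N => KroneckerModule.SubmodulePoint.extend (k := k)
      g'.hom N) h).trans (extend_tuplePoint (k := k) hd x hx hu g'.hom))⟩
    exact KroneckerModule.SubmodulePoint.ext (k := k) (extendSubmodule_comp (k := k) _ _ _)
      (extendSubmodule_comp (k := k) _ _ _)
  have h₁ : Locally A fun B g => IsTrivializedBy (k := k) N.N₁ g.hom :=
    locally_iff_forall_prime.2 fun p hp =>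
      (KroneckerModule.SubmodulePoint.isSubbundle₁ (k := k) N).exists_isTrivializedBy (k := k) p
  have h₂ : Locally A fun B g => IsTrivializedBy (k := k) N.N₂ g.hom :=
    locally_iff_forall_prime.2 fun p hp =>
      (KroneckerModule.SubmodulePoint.isSubbundle₂ (k := k) N).exists_isTrivializedBy (k := k) p
  -- Trivialize both lines on a common piece B first, then localize B further at an entry x_a.
  refine Locally.trans hstable ((h₁.and h₂ (fun _ _ _ g' h => h.comp (k := k) g'.hom)
    fun _ _ _ g' h => h.comp (k := k) g'.hom).mono ?_)
  rintro B g ⟨⟨(v : B ⊗[k] Module.Dual k (quotientPiece I d)), hv, hv'⟩,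
    ⟨(w : B ⊗[k] Module.Dual k (quotientPiece I (d - 1))), hw, hw'⟩⟩
  obtain ⟨x, hx, hxq⟩ := exists_scalars_of_span (k := k) hd (N.extend (k := k) g.hom) hv hv' hw'
  rw [locally_iff_forall_prime]
  intro p hp
  obtain ⟨a, ha⟩ : ∃ a, x a ∉ p := by
    by_contra! hc
    exact hp.ne_top (top_le_iff.1 (hx.symm.le.trans (Ideal.span_le.2 (Set.range_subset_iff.2 hc))))
  refine ⟨x a, ha, fun c => (toAway B (x a)).hom (x c), ?_⟩
  let t := (toAway B (x a)).hom
  obtain ⟨hx', h⟩ := exists_tuplePoint_eq (k := k) (A := Localization.Away (x a)) hd hI hf hdeg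
    ((N.extend (k := k) g.hom).extend (k := k) t) (hv.rTensor (k := k) t) (hw.rTensor (k := k) t)
    ((congrArg (extendSubmodule (k := k) t) hv').trans (extendSubmodule_span_singleton (k := k) t v))
    ((congrArg (extendSubmodule (k := k) t) hw').trans (extendSubmodule_span_singleton (k := k) t w))
    (x := fun c => t (x c)) (fun c q hq =>
      (dualTensorEquiv_rTensor (k := k) t v _).trans
        ((congrArg t (hxq c q hq)).trans ((map_mul t _ _).trans (congrArg (t (x c) * ·)
          (dualTensorEquiv_rTensor (k := k) t w _).symm))))
    (isUnit_toAway B (x a))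
  refine ⟨hx', ⟨a, isUnit_toAway B (x a)⟩, Eq.trans ?_ h⟩
  exact KroneckerModule.SubmodulePoint.ext (k := k) (extendSubmodule_comp (k := k) _ _ _)
      (extendSubmodule_comp (k := k) _ _ _)

end TupleLocal

/-! ### Morphisms to projective space from tuples -/

section ProjPoint

open MvPolynomial HomogeneousLocalization

variable {n : ℕ} {k : Type u} [Field k] {A B : Type u} [CommRing A] [Algebra k A] [CommRing B]
  [Algebra k B]

/-- Evaluation at `x` of the fractions of degree zero with denominators powers of `t`. -/
noncomputable def awayEval (t : MvPolynomial (Fin (n + 1)) k) (x : Fin (n + 1) → A)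
    (ht : IsUnit (aeval (R := k) x t)) : Away (polyGrading n k) t →+* A :=
  (IsLocalization.Away.lift (S := Localization.Away t) (g := (aeval (R := k) x).toRingHom) t ht).comp
    (algebraMap (Away (polyGrading n k) t) (Localization.Away t))

lemma awayEval_mk_mul {t : MvPolynomial (Fin (n + 1)) k} {x : Fin (n + 1) → A}
    (ht : IsUnit (aeval (R := k) x t)) (c : NumDenSameDeg (polyGrading n k) (.powers t)) :
    awayEval t x ht (HomogeneousLocalization.mk c) * aeval x (c.den : MvPolynomial (Fin (n + 1)) k) =
      aeval x (c.num : MvPolynomial (Fin (n + 1)) k) := by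
  have h : ∀ p, IsLocalization.Away.lift (S := Localization.Away t)
      (g := (aeval (R := k) x).toRingHom) t ht (algebraMap _ _ p) = aeval x p := fun p =>
    IsLocalization.Away.lift_eq t ht p
  rw [awayEval, RingHom.comp_apply, ← h, ← map_mul, ← h]
  congr 1
  rw [HomogeneousLocalization.algebraMap_apply, HomogeneousLocalization.val_mk,
    Localization.mk_eq_mk']
  exact IsLocalization.mk'_spec (M := Submonoid.powers t) (Localization.Away t) _ _

/-- Denominators are powers of t, hence become units, so the relation between numerator and
denominator determines the homomorphism. The identities below are verified through this criterion.
-/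
lemma awayEval_unique {t : MvPolynomial (Fin (n + 1)) k} {x : Fin (n + 1) → A}
    (ht : IsUnit (aeval (R := k) x t)) (φ : Away (polyGrading n k) t →+* A)
    (h : ∀ c : NumDenSameDeg (polyGrading n k) (.powers t), φ (HomogeneousLocalization.mk c) *
      aeval x (c.den : MvPolynomial (Fin (n + 1)) k) = aeval x (c.num : MvPolynomial (Fin (n + 1)) k)) :
    φ = awayEval t x ht := by
  ext z
  obtain ⟨c, rfl⟩ := HomogeneousLocalization.mk_surjective z
  obtain ⟨m, hm⟩ := c.den_mem
  have hu : IsUnit (aeval x (c.den : MvPolynomial (Fin (n + 1)) k)) := by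
    rw [← hm, map_pow]
    exact ht.pow m
  rw [← hu.mul_left_inj, h, awayEval_mk_mul]

lemma awayEval_comp {t : MvPolynomial (Fin (n + 1)) k} {x : Fin (n + 1) → A}
    (ht : IsUnit (aeval (R := k) x t)) (f : A →ₐ[k] B)
    (ht' : IsUnit (aeval (R := k) (fun c => f (x c)) t)) :
    f.toRingHom.comp (awayEval t x ht) = awayEval t (fun c => f (x c)) ht' := by
  refine awayEval_unique ht' _ fun c => ?_
  have := congrArg f (awayEval_mk_mul ht c)
  rw [map_mul, ← AlgHom.comp_apply, ← AlgHom.comp_apply, comp_aeval] at this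
  exact this

/-- Numerator and denominator have the same degree, so they scale by the same power of u. -/
lemma awayEval_smul {t : MvPolynomial (Fin (n + 1)) k} {x y : Fin (n + 1) → A}
    (hx : IsUnit (aeval (R := k) x t)) (hy : IsUnit (aeval (R := k) y t)) {u : A}
    (h : ∀ c, x c = u * y c) : awayEval t y hy = awayEval t x hx := by
  refine awayEval_unique hx _ fun c => ?_
  obtain rfl : x = fun c => u * y c := funext h
  rw [IsHomogeneous.aeval_smul c.den.2, IsHomogeneous.aeval_smul c.num.2, ← awayEval_mk_mul hy c]
  ring

lemma awayEval_comp_awayMap {t s t' : MvPolynomial (Fin (n + 1)) k} {e : ℕ}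
    (hs : s ∈ polyGrading n k e) (h : t' = t * s) {x : Fin (n + 1) → A}
    (ht : IsUnit (aeval (R := k) x t)) (hts : IsUnit (aeval (R := k) x t')) :
    (awayEval t' x hts).comp (awayMap (polyGrading n k) hs h) = awayEval t x ht := by
  ext z
  have : (IsLocalization.Away.lift (S := Localization.Away t')
      (g := (aeval (R := k) x).toRingHom) t' hts).comp (Localization.awayLift (algebraMap _ _) t
      (isUnit_of_dvd_unit (map_dvd _ ⟨_, h⟩) (IsLocalization.Away.algebraMap_isUnit t'))) =
      IsLocalization.Away.lift (S := Localization.Away t)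
        (g := (aeval (R := k) x).toRingHom) t ht := by
    refine IsLocalization.ringHom_ext (Submonoid.powers t) (RingHom.ext fun p => ?_)
    simp [Localization.awayLift]
  have h2 := congrArg (fun φ => φ z.val) this
  simp only [RingHom.comp_apply] at h2
  rw [← val_awayMap] at h2
  exact h2

lemma awayEval_comp_fromZero {t : MvPolynomial (Fin (n + 1)) k} {x : Fin (n + 1) → A}
    (ht : IsUnit (aeval (R := k) x t)) :
    ((awayEval t x ht).comp (fromZeroRingHom (polyGrading n k) _)).comp
      (algebraMap k (polyGrading n k 0)) = algebraMap k A := by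
  ext a
  have := awayEval_mk_mul ht ⟨0, algebraMap k (polyGrading n k 0) a, 1, one_mem _⟩
  simp only [SetLike.GradeZero.coe_one, map_one, mul_one] at this
  refine this.trans ?_
  exact (aeval (R := k) x).commutes a

/-- The fraction `X_c / X_b`. -/
noncomputable def coordFrac (n : ℕ) (k : Type u) [Field k] (b c : Fin (n + 1)) :
    Away (polyGrading n k) (X b) :=
  HomogeneousLocalization.mk ⟨1, ⟨X c, isHomogeneous_X k c⟩, ⟨X b, isHomogeneous_X k b⟩,
    ⟨1, pow_one _⟩⟩

lemma coordFrac_self (b : Fin (n + 1)) : coordFrac n k b b = 1 := by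
  apply HomogeneousLocalization.val_injective
  rw [coordFrac, HomogeneousLocalization.val_mk, HomogeneousLocalization.val_one]
  exact Localization.mk_self (⟨X b, ⟨1, pow_one _⟩⟩ : Submonoid.powers
    (X b : MvPolynomial (Fin (n + 1)) k))

lemma awayEval_coordFrac_mul {b : Fin (n + 1)} {x : Fin (n + 1) → A}
    (hb : IsUnit (aeval (R := k) x (X b))) (c : Fin (n + 1)) :
    awayEval (X b) x hb (coordFrac n k b c) * x b = x c := by
  have := awayEval_mk_mul hb ⟨1, ⟨X c, isHomogeneous_X k c⟩, ⟨X b, isHomogeneous_X k b⟩,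
    ⟨1, pow_one _⟩⟩
  simpa only [aeval_X, coordFrac] using this

/-- The fraction `p / X_b ^ m`, for `p` homogeneous of degree `m`. -/
noncomputable def homogFrac (b : Fin (n + 1)) {p : MvPolynomial (Fin (n + 1)) k} {m : ℕ}
    (hp : p.IsHomogeneous m) : Away (polyGrading n k) (X b) :=
  HomogeneousLocalization.mk ⟨m, ⟨p, hp⟩, ⟨X b ^ m, isHomogeneous_X_pow b m⟩, ⟨m, rfl⟩⟩

/-- In the ring of degree zero fractions, p / X_b^m = p(X_0/X_b, …, X_n/X_b). The hypothesis on φ is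
k-linearity, which lets φ pass through the polynomial p. -/
lemma map_homogFrac {b : Fin (n + 1)} (φ : Away (polyGrading n k) (X b) →+* A)
    (hφ : (φ.comp (fromZeroRingHom (polyGrading n k) _)).comp
      (algebraMap k (polyGrading n k 0)) = algebraMap k A)
    {p : MvPolynomial (Fin (n + 1)) k} {m : ℕ} (hp : p.IsHomogeneous m) :
    φ (homogFrac b hp) = aeval (fun c => φ (coordFrac n k b c)) p := by
  let δ : MvPolynomial (Fin (n + 1)) k →+* Away (polyGrading n k) (X b) :=
    eval₂Hom ((fromZeroRingHom (polyGrading n k) _).comp (algebraMap k (polyGrading n k 0)))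
      (coordFrac n k b)
  have hδ : δ p = homogFrac b hp := by
    apply HomogeneousLocalization.val_injective
    -- This is 1/X_b; homogeneity of p pulls out u^m from the evaluation at the u X_c.
    let u : Localization.Away (X b : MvPolynomial (Fin (n + 1)) k) :=
      Localization.mk 1 ⟨X b, ⟨1, pow_one _⟩⟩
    have h1 : (algebraMap _ (Localization.Away (X b : MvPolynomial (Fin (n + 1)) k))).comp δ =
        (aeval (R := k) fun c => u * algebraMap (MvPolynomial (Fin (n + 1)) k)
          (Localization.Away (X b : MvPolynomial (Fin (n + 1)) k)) (X c)).toRingHom := by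
      refine MvPolynomial.ringHom_ext (fun a => ?_) fun c => ?_
      · simp only [δ, RingHom.comp_apply, coe_eval₂Hom, eval₂_C]
        refine Eq.trans ?_ ((aeval (R := k) _).commutes a).symm
        rw [IsScalarTower.algebraMap_apply k (MvPolynomial (Fin (n + 1)) k)
          (Localization.Away (X b : MvPolynomial (Fin (n + 1)) k))]
        exact Localization.mk_one_eq_algebraMap _
      · simp only [δ, RingHom.comp_apply, coe_eval₂Hom, eval₂_X]
        refine Eq.trans ?_ (aeval_X _ c).symm
        rw [← Localization.mk_one_eq_algebraMap, Localization.mk_mul]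
        simp [coordFrac]
    have h2 := congrArg (fun ψ => ψ p) h1
    refine h2.trans ((hp.aeval_smul u _).trans ?_)
    have h3 : aeval (R := k) (fun c => algebraMap (MvPolynomial (Fin (n + 1)) k)
      (Localization.Away (X b : MvPolynomial (Fin (n + 1)) k)) (X c)) p = algebraMap _ _ p := by
      refine (aeval_algebraMap_apply _ X p).trans ?_
      rw [aeval_X_left_apply]
    rw [h3, ← Localization.mk_one_eq_algebraMap, Localization.mk_pow, Localization.mk_mul,
      one_pow, one_mul, mul_one]
    rfl
  rw [← hδ, aeval_def, ← hφ]
  exact hom_eval₂ p _ φ _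

lemma eq_awayEval {b : Fin (n + 1)} (φ : Away (polyGrading n k) (X b) →+* A)
    (hφ : (φ.comp (fromZeroRingHom (polyGrading n k) _)).comp
      (algebraMap k (polyGrading n k 0)) = algebraMap k A)
    (hu : IsUnit (aeval (R := k) (fun c => φ (coordFrac n k b c)) (X b))) :
    φ = awayEval (X b) (fun c => φ (coordFrac n k b c)) hu := by
  refine awayEval_unique hu _ fun ⟨m, p, ⟨q, hq⟩, ⟨l, hl⟩⟩ => ?_
  have hl : X b ^ l = q := hl
  subst hl
  -- The nonzero form X_b^l has only one degree, so the fraction is of the shape treated by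
  -- `map_homogFrac`.
  have hlm : l = m := by
    refine (isHomogeneous_X_pow (R := k) b l).inj_right hq (pow_ne_zero _ (X_ne_zero b))
  subst hlm
  refine Eq.trans ?_ (map_homogFrac φ hφ p.2)
  rw [map_pow, aeval_X, coordFrac_self, map_one, one_pow, mul_one]
  rfl

lemma X_mem_polyGrading (a : Fin (n + 1)) : X a ∈ polyGrading n k 1 :=
  isHomogeneous_X k a

/-- The morphism `Spec A ⟶ ℙⁿ` given by a tuple at which the form `t` is invertible. -/
noncomputable def projPoint {t : MvPolynomial (Fin (n + 1)) k} {m : ℕ} (ht : t ∈ polyGrading n k m)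
    (hm : 0 < m) (x : Fin (n + 1) → A) (hu : IsUnit (aeval (R := k) x t)) :
    Spec (CommRingCat.of A) ⟶ Proj (polyGrading n k) :=
  Spec.map (CommRingCat.ofHom (awayEval t x hu)) ≫ Proj.awayι (polyGrading n k) t ht hm

lemma projPoint_eq_of_eq_mul {t s t' : MvPolynomial (Fin (n + 1)) k} {m e m' : ℕ}
    (ht : t ∈ polyGrading n k m) (hm : 0 < m) (hs : s ∈ polyGrading n k e)
    (ht' : t' ∈ polyGrading n k m') (hm' : 0 < m') (h : t' = t * s) (x : Fin (n + 1) → A)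
    (hu : IsUnit (aeval (R := k) x t)) (hu' : IsUnit (aeval (R := k) x t')) (hme : m' = m + e) :
    projPoint ht hm x hu = projPoint ht' hm' x hu' := by
  subst hme
  rw [projPoint, projPoint, ← awayEval_comp_awayMap hs h hu hu', CommRingCat.ofHom_comp,
    Spec.map_comp, Category.assoc, Proj.SpecMap_awayMap_awayι]

/-- Both morphisms factor through D₊(X_a X_b). Hence `tupleToProj` does not depend on the chosen
unit entry. -/
lemma projPoint_X_eq (x : Fin (n + 1) → A) {a b : Fin (n + 1)}
    (ha : IsUnit (aeval (R := k) x (X a))) (hb : IsUnit (aeval (R := k) x (X b))) :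
    projPoint (X_mem_polyGrading a) one_pos x ha = projPoint (X_mem_polyGrading b) one_pos x hb := by
  have hab : IsUnit (aeval (R := k) x (X a * X b)) := by
    rw [map_mul]
    exact ha.mul hb
  have h : (X a * X b : MvPolynomial (Fin (n + 1)) k) ∈ polyGrading n k 2 :=
    (isHomogeneous_X k a).mul (isHomogeneous_X k b)
  rw [projPoint_eq_of_eq_mul _ _ (X_mem_polyGrading b) h two_pos rfl x ha hab rfl,
    projPoint_eq_of_eq_mul _ _ (X_mem_polyGrading a) h two_pos (mul_comm _ _) x hb hab rfl]

variable (k) in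
lemma isUnit_aeval_X {x : Fin (n + 1) → A} {a : Fin (n + 1)} (ha : IsUnit (x a)) :
    IsUnit (aeval (R := k) x (X a)) := by
  rwa [aeval_X]

variable (k) in
/-- The morphism `Spec A ⟶ ℙⁿ` given by a tuple with an invertible entry. -/
noncomputable def tupleToProj (x : Fin (n + 1) → A) (hu : ∃ a, IsUnit (x a)) :
    Spec (CommRingCat.of A) ⟶ Proj (polyGrading n k) :=
  projPoint (X_mem_polyGrading hu.choose) one_pos x (isUnit_aeval_X k hu.choose_spec)

lemma tupleToProj_eq_projPoint (x : Fin (n + 1) → A) {a : Fin (n + 1)} (ha : IsUnit (x a)) :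
    tupleToProj k x ⟨a, ha⟩ =
      projPoint (X_mem_polyGrading a) one_pos x (isUnit_aeval_X k ha) :=
  projPoint_X_eq _ _ _

lemma SpecMap_tupleToProj (x : Fin (n + 1) → A) (hu : ∃ a, IsUnit (x a)) (f : A →ₐ[k] B) :
    Spec.map (CommRingCat.ofHom f.toRingHom) ≫ tupleToProj k x hu =
      tupleToProj k (fun c => f (x c)) (hu.imp fun _ h => h.map f) := by
  obtain ⟨a, ha⟩ := hu
  rw [tupleToProj_eq_projPoint x ha, tupleToProj_eq_projPoint _ (ha.map f), projPoint, projPoint,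
    ← Category.assoc, ← Spec.map_comp, ← CommRingCat.ofHom_comp, awayEval_comp]

lemma tupleToProj_eq {x y : Fin (n + 1) → A} (hx : ∃ a, IsUnit (x a)) (hy : ∃ a, IsUnit (y a))
    {u : A} (hu : IsUnit u) (h : ∀ c, x c = u * y c) : tupleToProj k x hx = tupleToProj k y hy := by
  obtain ⟨a, ha⟩ := hy
  have hxa : IsUnit (x a) := by
    rw [h]
    exact hu.mul ha
  rw [tupleToProj_eq_projPoint x hxa, tupleToProj_eq_projPoint y ha, projPoint, projPoint,
    awayEval_smul _ _ h]

lemma tupleToProj_comp_toSpec (x : Fin (n + 1) → A) (hu : ∃ a, IsUnit (x a)) :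
    tupleToProj k x hu ≫ projectiveSpaceToSpec n k =
      Spec.map (CommRingCat.ofHom (algebraMap k A)) := by
  change tupleToProj k x hu ≫ Proj.toSpecZero (polyGrading n k) ≫ Spec.map _ = _
  rw [tupleToProj, projPoint, Category.assoc, Proj.awayι_toSpecZero_assoc,
    ← Spec.map_comp, ← Spec.map_comp, ← CommRingCat.ofHom_comp, ← CommRingCat.ofHom_comp]
  exact congrArg (fun φ => Spec.map (CommRingCat.ofHom φ))
    (awayEval_comp_fromZero (isUnit_aeval_X k hu.choose_spec))

lemma exists_unit_of_tupleToProj_eq {x y : Fin (n + 1) → A} (hx : ∃ a, IsUnit (x a))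
    (hy : ∃ a, IsUnit (y a)) (h : tupleToProj k x hx = tupleToProj k y hy) :
    ∃ u, IsUnit u ∧ ∀ c, x c = u * y c := by
  obtain ⟨b, hb⟩ := hy
  -- Otherwise some maximal ideal contains x_b. At that point the morphism given by y lies in
  -- D₊(X_b), while the one given by x does not.
  have hxb : IsUnit (x b) := by
    obtain ⟨a, ha⟩ := hx
    by_contra hn
    obtain ⟨p, hp, hbp⟩ := exists_max_ideal_of_mem_nonunits hn
    let P : Spec (CommRingCat.of A) := ⟨p, hp.isPrime⟩
    have h1 : tupleToProj k y ⟨b, hb⟩ P ∈ Proj.basicOpen (polyGrading n k) (X b) := by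
      rw [tupleToProj_eq_projPoint y hb, projPoint,
        ← Proj.opensRange_awayι (polyGrading n k) _ (X_mem_polyGrading b) one_pos]
      exact ⟨_, rfl⟩
    rw [← h, tupleToProj_eq_projPoint x ha, projPoint] at h1
    have h2 : (Spec.map (CommRingCat.ofHom (awayEval (X a) x (isUnit_aeval_X k ha)))) P ∈
        Proj.awayι (polyGrading n k) _ (X_mem_polyGrading a) one_pos ⁻¹ᵁ
          Proj.basicOpen (polyGrading n k) (X b) := h1
    rw [Proj.awayι_preimage_basicOpen (polyGrading n k) (X_mem_polyGrading a) one_pos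
      (X_mem_polyGrading b) one_pos] at h2
    refine h2 (?_ : awayEval (X a) x (isUnit_aeval_X k ha) _ ∈ p)
    have h3 : awayEval (X a) x (isUnit_aeval_X k ha) (Away.isLocalizationElem
        (X_mem_polyGrading a) (X_mem_polyGrading b)) * aeval x (X a ^ 1) = aeval x (X b ^ 1) :=
      awayEval_mk_mul (isUnit_aeval_X k ha) ⟨1 • 1, ⟨X b ^ 1, isHomogeneous_X_pow b 1⟩,
        ⟨X a ^ 1, isHomogeneous_X_pow a 1⟩, ⟨1, rfl⟩⟩
    rw [pow_one, pow_one, aeval_X, aeval_X] at h3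
    refine (hp.isPrime.mem_or_mem (h3.symm ▸ hbp)).resolve_right fun hap =>
      hp.ne_top (Ideal.eq_top_of_isUnit_mem _ hap ha)
  rw [tupleToProj_eq_projPoint x hxb, tupleToProj_eq_projPoint y hb, projPoint, projPoint,
    cancel_mono] at h
  have h3 := congrArg CommRingCat.Hom.hom (Spec.map_injective h)
  have h4 : ∀ c, awayEval (X b) x (isUnit_aeval_X k hxb) (coordFrac n k b c) =
    awayEval (X b) y (isUnit_aeval_X k hb) (coordFrac n k b c) := fun c =>
      congrArg (fun φ => φ (coordFrac n k b c)) h3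
  have hyb := isUnit_aeval_X k hb
  have h6 := awayEval_coordFrac_mul hyb
  obtain ⟨v, hv⟩ := hb
  -- Both morphisms factor through D₊(X_b) and give X_c/X_b the same value, so the factor is x_b /
  -- y_b.
  refine ⟨x b * (↑v⁻¹ : A), hxb.mul v⁻¹.isUnit, fun c => ?_⟩
  have h5 := awayEval_coordFrac_mul (isUnit_aeval_X k hxb) c
  rw [h4] at h5
  have hv' : (↑v⁻¹ : A) * y b = 1 := by rw [← hv, Units.inv_mul]
  linear_combination -h5 + x b * (↑v⁻¹ : A) * h6 c -
    awayEval (X b) y hyb (coordFrac n k b c) * x b * hv'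

end ProjPoint

/-! ### Points of closed subschemes of projective space -/

lemma AlgebraicGeometry.IsAffineOpen.exists_eq_SpecMap_comp_fromSpec {X : Scheme.{u}} {U : X.Opens}
    (hU : IsAffineOpen U) {B : CommRingCat.{u}} (g : Spec B ⟶ X) (h : Set.range g ⊆ U) :
    ∃ θ : Γ(X, U) ⟶ B, g = Spec.map θ ≫ hU.fromSpec := by
  have h' : Set.range g ⊆ Set.range hU.fromSpec := by rwa [hU.range_fromSpec]
  refine ⟨Spec.preimage (IsOpenImmersion.lift hU.fromSpec g h'), ?_⟩
  rw [Spec.map_preimage, IsOpenImmersion.lift_fac]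

/-- It links the two charts on D₊(f): the one from sections, used in the definition of X, and the
one from degree zero fractions, used for tuples. -/
lemma AlgebraicGeometry.Proj.fromSpec_basicOpen {σ A : Type u} [CommRing A] [SetLike σ A]
    [AddSubgroupClass σ A] (𝒜 : ℕ → σ) [GradedRing 𝒜] {f : A} {m : ℕ} (hf : f ∈ 𝒜 m)
    (hm : 0 < m) :
    (Proj.isAffineOpen_basicOpen 𝒜 f hf hm).fromSpec =
      Spec.map (Proj.awayToSection 𝒜 f) ≫ Proj.awayι 𝒜 f hf hm := by
  have hD := Proj.isAffineOpen_basicOpen 𝒜 f hf hm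
  have : IsIso (Proj.basicOpen 𝒜 f).toSpecΓ := by
    rw [← hD.isoSpec_hom]
    infer_instance
  rw [← cancel_epi (Proj.basicOpen 𝒜 f).toSpecΓ, hD.toSpecΓ_fromSpec, ← Category.assoc]
  have h : (Proj.basicOpen 𝒜 f).toSpecΓ ≫ Spec.map (Proj.awayToSection 𝒜 f) =
      (Proj.basicOpenIsoSpec 𝒜 f hf hm).hom := (Proj.basicOpenIsoSpec_hom 𝒜 f hf hm).symm
  rw [h, ← Proj.basicOpenIsoSpec_inv_ι, Iso.hom_inv_id_assoc]

section ClosedSubscheme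

open MvPolynomial HomogeneousLocalization

variable {n : ℕ} {k : Type u} [Field k] {Y : Scheme.{u}} (i : Y ⟶ Proj (polyGrading n k))

/-- The ring homomorphism from the fractions with denominators powers of `X_a` to the functions on
the preimage of `D₊(X_a)`. -/
noncomputable def awayToPreimage (a : Fin (n + 1)) :
    CommRingCat.of (Away (polyGrading n k) (X a)) ⟶
      Γ(Y, i ⁻¹ᵁ Proj.basicOpen (polyGrading n k) (X a)) :=
  Proj.awayToSection (polyGrading n k) (X a) ≫ i.app _

variable {i} {r : ℕ} {f : Fin r → MvPolynomial (Fin (n + 1)) k} {deg : Fin r → ℕ}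
  {hf : ∀ j, (f j).IsHomogeneous (deg j)}

lemma IsDefinedBy.ker_awayToPreimage (hX : IsDefinedBy i f deg hf) (a : Fin (n + 1)) :
    RingHom.ker (awayToPreimage i a).hom = Ideal.span (Set.range fun j => homogFrac a (hf j)) := by
  have hb : Function.Bijective (Proj.awayToSection (polyGrading n k) (X a)).hom :=
    (Proj.basicOpenIsoAway (polyGrading n k) _ (X_mem_polyGrading a)
      one_pos).commRingCatIsoToRingEquiv.bijective
  have h1 : RingHom.ker (i.app (Proj.basicOpen (polyGrading n k) (X a))).hom =
      (Ideal.span (Set.range fun j => homogFrac a (hf j))).map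
        (Proj.awayToSection (polyGrading n k) (X a)).hom := by
    refine (hX a).trans ?_
    rw [Ideal.map_span, ← Set.range_comp]
    rfl
  rw [← Ideal.comap_map_of_bijective _ hb (I := Ideal.span _), ← h1]
  exact (RingHom.comap_ker _ _).symm

variable (i) [IsClosedImmersion i]

lemma isAffineOpen_preimage_basicOpen (a : Fin (n + 1)) :
    IsAffineOpen (i ⁻¹ᵁ Proj.basicOpen (polyGrading n k) (X a)) :=
  (Proj.isAffineOpen_basicOpen _ _ (X_mem_polyGrading a) one_pos).preimage i

lemma fromSpec_preimage_comp (a : Fin (n + 1)) :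
    (isAffineOpen_preimage_basicOpen i a).fromSpec ≫ i = Spec.map (awayToPreimage i a) ≫
      Proj.awayι (polyGrading n k) (X a) (X_mem_polyGrading a) one_pos := by
  rw [awayToPreimage, Spec.map_comp, Category.assoc, ← Proj.fromSpec_basicOpen,
    Scheme.Hom.app_eq_appLE,
    IsAffineOpen.SpecMap_appLE_fromSpec i (Proj.isAffineOpen_basicOpen _ _ (X_mem_polyGrading a)
      one_pos) (isAffineOpen_preimage_basicOpen i a)]

lemma awayToPreimage_surjective (a : Fin (n + 1)) : Function.Surjective (awayToPreimage i a) := by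
  have hD := Proj.isAffineOpen_basicOpen (polyGrading n k) _ (X_mem_polyGrading a) one_pos
  have h := Scheme.Hom.app_surjective i _ hD
  intro z
  obtain ⟨y, rfl⟩ := h z
  refine ⟨(Proj.basicOpenIsoAway (polyGrading n k) _ (X_mem_polyGrading a) one_pos).inv y, ?_⟩
  have h2 := congrArg (fun φ => φ y)
    (Proj.basicOpenIsoAway (polyGrading n k) _ (X_mem_polyGrading a) one_pos).inv_hom_id
  exact congrArg (i.app _) h2

variable {i} {A : Type u} [CommRing A] [Algebra k A]

/-- Over D₊(X_a) the subscheme is the spectrum of the quotient by the f_j / X_a^(deg f_j).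
Evaluation at x kills these fractions, so it factors through the quotient. -/
lemma IsDefinedBy.exists_lift (hX : IsDefinedBy i f deg hf) (x : Fin (n + 1) → A)
    (hx : Ideal.span (Set.range f) ≤ RingHom.ker (aeval (R := k) x)) (hu : ∃ a, IsUnit (x a)) :
    ∃ g : Spec (CommRingCat.of A) ⟶ Y, g ≫ i = tupleToProj k x hu := by
  obtain ⟨a, ha⟩ := hu
  have hua := isUnit_aeval_X k ha
  have hker : RingHom.ker (awayToPreimage i a).hom ≤ RingHom.ker (awayEval (X a) x hua) := by
    rw [hX.ker_awayToPreimage, Ideal.span_le]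
    rintro _ ⟨j, rfl⟩
    have h := awayEval_mk_mul hua ⟨deg j, ⟨f j, hf j⟩, ⟨X a ^ deg j, isHomogeneous_X_pow a _⟩,
      ⟨deg j, rfl⟩⟩
    rw [show aeval x (f j) = 0 from hx (Ideal.subset_span ⟨j, rfl⟩)] at h
    refine (IsUnit.mul_left_eq_zero ?_).1 h
    rw [map_pow]
    exact hua.pow _
  let θ := RingHom.liftOfSurjective (awayToPreimage i a).hom (awayToPreimage_surjective i a)
    ⟨awayEval (X a) x hua, hker⟩
  have hθ : θ.comp (awayToPreimage i a).hom = awayEval (X a) x hua :=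
    RingHom.liftOfRightInverse_comp _ _ _ _
  refine ⟨Spec.map (CommRingCat.ofHom θ) ≫ (isAffineOpen_preimage_basicOpen i a).fromSpec, ?_⟩
  rw [tupleToProj_eq_projPoint x ha, projPoint, Category.assoc, fromSpec_preimage_comp,
    ← Spec.map_comp_assoc, ← hθ]
  rfl

lemma iSup_basicOpen_X : ⨆ a, Proj.basicOpen (polyGrading n k) (X a) = ⊤ := by
  refine Proj.iSup_basicOpen_eq_top' _ _ (fun a => ⟨1, X_mem_polyGrading a⟩) ?_
  refine top_le_iff.1 fun p _ => ?_
  have h : p ∈ Algebra.adjoin k (Set.range X) := by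
    rw [adjoin_range_X]
    trivial
  refine Algebra.adjoin_induction (fun x hx => Algebra.subset_adjoin hx) (fun c => ?_)
    (fun _ _ _ _ => add_mem) (fun _ _ _ _ => mul_mem) h
  exact Subalgebra.algebraMap_mem _ (algebraMap k (polyGrading n k 0) c)

lemma IsDefinedBy.exists_tuple (hX : IsDefinedBy i f deg hf) (g : Spec (CommRingCat.of A) ⟶ Y)
    (hg : (g ≫ i) ≫ projectiveSpaceToSpec n k = Spec.map (CommRingCat.ofHom (algebraMap k A)))
    {a : Fin (n + 1)}
    (ha : Set.range g ⊆ i ⁻¹ᵁ Proj.basicOpen (polyGrading n k) (X a)) :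
    ∃ (x : Fin (n + 1) → A) (_ : Ideal.span (Set.range f) ≤ RingHom.ker (aeval (R := k) x))
      (hu : ∃ a, IsUnit (x a)), g ≫ i = tupleToProj k x hu := by
  obtain ⟨θ, hθ⟩ := (isAffineOpen_preimage_basicOpen i a).exists_eq_SpecMap_comp_fromSpec g ha
  let φ : Away (polyGrading n k) (X a) →+* A := θ.hom.comp (awayToPreimage i a).hom
  have hgi : g ≫ i = Spec.map (CommRingCat.ofHom φ) ≫
      Proj.awayι (polyGrading n k) (X a) (X_mem_polyGrading a) one_pos := by
    rw [hθ, Category.assoc, fromSpec_preimage_comp, ← Spec.map_comp_assoc]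
    rfl
  have hφ : (φ.comp (fromZeroRingHom (polyGrading n k) _)).comp
      (algebraMap k (polyGrading n k 0)) = algebraMap k A := by
    replace hg : (g ≫ i) ≫ Proj.toSpecZero (polyGrading n k) ≫
      Spec.map (CommRingCat.ofHom (algebraMap k (polyGrading n k 0))) = _ := hg
    rw [hgi, Category.assoc, Proj.awayι_toSpecZero_assoc, ← Spec.map_comp, ← Spec.map_comp] at hg
    exact congrArg CommRingCat.Hom.hom (Spec.map_injective hg)
  have hu : IsUnit (φ (coordFrac n k a a)) := by
    rw [coordFrac_self, map_one]
    exact isUnit_one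
  -- The coordinates are the values of X_c / X_a, normalized so that the a-th entry is 1.
  refine ⟨fun c => φ (coordFrac n k a c), ?_, ⟨a, hu⟩, ?_⟩
  · rw [Ideal.span_le]
    rintro _ ⟨j, rfl⟩
    refine (map_homogFrac φ hφ (hf j)).symm.trans ?_
    have h : homogFrac a (hf j) ∈ RingHom.ker (awayToPreimage i a).hom := by
      rw [hX.ker_awayToPreimage]
      exact Ideal.subset_span ⟨j, rfl⟩
    exact (congrArg θ h).trans (map_zero θ.hom)
  · rw [tupleToProj_eq_projPoint _ hu, projPoint, hgi]
    exact congrArg (fun ψ => Spec.map (CommRingCat.ofHom ψ) ≫ _)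
      (eq_awayEval φ hφ (isUnit_aeval_X k hu))

end ClosedSubscheme

/-! ### Comparison of the functors of points -/

section Comparison

open MvPolynomial

variable {k : Type u} [Field k] {n r d : ℕ} {X : Scheme.{u}} (i : X ⟶ projectiveSpace n k)
  (I : Ideal (MvPolynomial (Fin (n + 1)) k)) (hd : 1 ≤ d)

/-- A point of `X` and a point of the quiver grassmannian are related if they are given by the same
tuple of homogeneous coordinates. -/
def TupleRel ⦃A : CommAlgCat.{u} (CommRingCat.of k)⦄
    (g : (schemePoints (Over.mk (i ≫ projectiveSpaceToSpec n k))).obj A)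
    (N : ((multiplicationModule I d hd).dual.grassmannianFunctor 1 1).obj A) : Prop :=
  ∃ (x : Fin (n + 1) → A) (hx : I ≤ RingHom.ker (aeval (R := k) x)) (hu : ∃ a, IsUnit (x a)),
    (pointHom g : Spec (CommRingCat.of A) ⟶ X) ≫ i = tupleToProj k x hu ∧
      N = tuplePoint (k := k) I hd x hx hu

variable {i I}

lemma TupleRel.map {A B : CommAlgCat.{u} (CommRingCat.of k)} (φ : A ⟶ B)
    (g : (schemePoints (Over.mk (i ≫ projectiveSpaceToSpec n k))).obj A)
    (N : ((multiplicationModule I d hd).dual.grassmannianFunctor 1 1).obj A)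
    (h : TupleRel i I hd g N) : TupleRel i I hd ((schemePoints _).map φ g)
      (((multiplicationModule I d hd).dual.grassmannianFunctor 1 1).map φ N) := by
  obtain ⟨x, hx, hu, hg, rfl⟩ := h
  refine ⟨fun c => φ.hom (x c), le_ker_aeval_comp (k := k) hx φ.hom, hu.imp fun _ h => h.map φ.hom,
    ?_, extend_tuplePoint (k := k) hd x hx hu φ.hom⟩
  rw [pointHom_map]
  refine (Category.assoc _ _ _).trans ?_
  refine (congrArg (Spec.map (CommRingCat.ofHom φ.hom.toRingHom) ≫ ·) hg).trans ?_
  exact SpecMap_tupleToProj (k := k) x hu φ.hom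

lemma TupleRel.right_unique {A : CommAlgCat.{u} (CommRingCat.of k)}
    {g : (schemePoints (Over.mk (i ≫ projectiveSpaceToSpec n k))).obj A}
    {N N' : ((multiplicationModule I d hd).dual.grassmannianFunctor 1 1).obj A}
    (h : TupleRel i I hd g N) (h' : TupleRel i I hd g N') : N = N' := by
  obtain ⟨x, hx, hu, hg, rfl⟩ := h
  obtain ⟨x', hx', hu', hg', rfl⟩ := h'
  obtain ⟨u, huu, h⟩ := exists_unit_of_tupleToProj_eq (k := k) hu hu' (hg.symm.trans hg')
  exact tuplePoint_eq (k := k) hd hx hx' hu hu' huu h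

/-- Equal submodules determine the tuple up to a unit, hence the morphism to projective space, and i
is a monomorphism. -/
lemma TupleRel.left_unique [Mono i] {A : CommAlgCat.{u} (CommRingCat.of k)}
    {g g' : (schemePoints (Over.mk (i ≫ projectiveSpaceToSpec n k))).obj A}
    {N : ((multiplicationModule I d hd).dual.grassmannianFunctor 1 1).obj A}
    (h : TupleRel i I hd g N) (h' : TupleRel i I hd g' N) : g = g' := by
  obtain ⟨x, hx, hu, hg, rfl⟩ := h
  obtain ⟨x', hx', hu', hg', hN⟩ := h'
  obtain ⟨u, huu, h⟩ := exists_unit_of_tuplePoint_eq (k := k) hd hx hx' hu hu' hN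
  refine pointHom_injective ((cancel_mono i).1 ?_)
  exact hg.trans ((tupleToProj_eq (k := k) hu hu' huu h).trans hg'.symm)

variable {f : Fin r → MvPolynomial (Fin (n + 1)) k} {deg : Fin r → ℕ}
  {hf : ∀ j, (f j).IsHomogeneous (deg j)} [IsClosedImmersion i]

lemma IsDefinedBy.locally_exists_tupleRel_right (hX : IsDefinedBy i f deg hf)
    {A : CommAlgCat.{u} (CommRingCat.of k)}
    (g : (schemePoints (Over.mk (i ≫ projectiveSpaceToSpec n k))).obj A) :
    Locally A fun _ φ => ∃ N, TupleRel i (Ideal.span (Set.range f)) hd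
      ((schemePoints _).map φ g) N := by
  have : IsClosedImmersion (Y := Proj (polyGrading n k)) i := ‹_›
  refine locally_iff_forall_prime.2 fun p hp => ?_
  let q : Spec (CommRingCat.of A) ⟶ X := pointHom g
  let P : Spec (CommRingCat.of A) := ⟨p, hp⟩
  have hP : i (q P) ∈ ⨆ a, Proj.basicOpen (polyGrading n k) (MvPolynomial.X a) := by
    rw [iSup_basicOpen_X]
    trivial
  obtain ⟨a, ha⟩ := TopologicalSpace.Opens.mem_iSup.1 hP
  let W : (Spec (CommRingCat.of A)).Opens :=
    q ⁻¹ᵁ i ⁻¹ᵁ Proj.basicOpen (polyGrading n k) (MvPolynomial.X a)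
  -- A basic open neighbourhood of p on which the morphism lands in the single chart D₊(X_a), where
  -- coordinates exist.
  obtain ⟨_, ⟨_, ⟨h, rfl⟩, rfl⟩, hPh, hhW⟩ := PrimeSpectrum.isBasis_basic_opens.exists_subset_of_mem_open
    (show P ∈ (W : Set _) from ha) W.2
  refine ⟨h, hPh, ?_⟩
  let φ : CommRingCat.of A ⟶ CommRingCat.of (awayObj A h) :=
    CommRingCat.ofHom (toAway A h).hom.toRingHom
  have hrange : Set.range (Spec.map φ ≫ q) ⊆
      ((i : X ⟶ Proj (polyGrading n k)) ⁻¹ᵁ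
        Proj.basicOpen (polyGrading n k) (MvPolynomial.X a) : X.Opens) := by
    rintro _ ⟨z, rfl⟩
    refine hhW (fun hz => z.2.ne_top (Ideal.eq_top_of_isUnit_mem _ hz (isUnit_toAway A h)))
  obtain ⟨x, hx, hu, h⟩ := hX.exists_tuple (k := k) (A := awayObj A h) (Spec.map φ ≫ q)
    ((Category.assoc _ _ _).trans (pointHom_comp_hom ((schemePoints _).map (toAway A h) g))) hrange
  exact ⟨_, x, hx, hu, h, rfl⟩

lemma IsDefinedBy.locally_exists_tupleRel_left (hX : IsDefinedBy i f deg hf)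
    (hdeg : ∀ j, deg j ≤ d) {A : CommAlgCat.{u} (CommRingCat.of k)}
    (N : ((multiplicationModule (Ideal.span (Set.range f)) d hd).dual.grassmannianFunctor 1 1).obj
      A) :
    Locally A fun _ φ => ∃ g, TupleRel i (Ideal.span (Set.range f)) hd g
      (((multiplicationModule (Ideal.span (Set.range f)) d hd).dual.grassmannianFunctor 1 1).map
        φ N) := by
  refine (locally_exists_tuplePoint hd rfl hf hdeg N).mono ?_
  rintro B φ ⟨x, hx, hu, h⟩
  have : IsClosedImmersion (Y := Proj (polyGrading n k)) i := ‹_›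
  obtain ⟨g, hg⟩ := hX.exists_lift (k := k) x hx hu
  refine ⟨pointMk (X := Over.mk (i ≫ projectiveSpaceToSpec n k)) g ?_, x, hx, hu, hg, h⟩
  refine (Category.assoc _ _ _).symm.trans ?_
  exact (congrArg (· ≫ projectiveSpaceToSpec n k) hg).trans
    (tupleToProj_comp_toSpec (k := k) x hu)

lemma IsDefinedBy.isLocalGraph (hX : IsDefinedBy i f deg hf) :
    IsLocalGraph (TupleRel i (Ideal.span (Set.range f)) hd) where
  map _ _ := TupleRel.map hd
  unique _ _ _ _ := TupleRel.right_unique hd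
  exists_locally _ := hX.locally_exists_tupleRel_right hd

lemma IsDefinedBy.isLocalGraph_flip (hX : IsDefinedBy i f deg hf) (hdeg : ∀ j, deg j ≤ d) :
    IsLocalGraph (R := CommRingCat.of k)
      fun _ N g => TupleRel i (Ideal.span (Set.range f)) hd g N where
  map _ _ φ N g := TupleRel.map hd φ g N
  unique _ _ _ _ := TupleRel.left_unique hd
  exists_locally _ := hX.locally_exists_tupleRel_left hd hdeg

end Comparison

theorem theorem2 {k : Type u} [Field k] (n r d : ℕ) (hd : 1 ≤ d)
    (f : Fin r → MvPolynomial (Fin (n + 1)) k) (deg : Fin r → ℕ)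
    (hf : ∀ j, (f j).IsHomogeneous (deg j)) (hdeg : ∀ j, deg j ≤ d)
    (X : Scheme.{u}) (i : X ⟶ projectiveSpace n k) (hi : IsClosedImmersion i)
    (hX : IsDefinedBy i f deg hf) :
    IsQuiverGrassmannian (Over.mk (i ≫ projectiveSpaceToSpec n k))
      (multiplicationModule (Ideal.span (Set.range f)) d hd).dual 1 1 := by
  have : Module.Finite k (multiplicationModule (Ideal.span (Set.range f)) d hd).dual.M₁ :=
    (inferInstance : Module.Finite k (Module.Dual k (quotientPiece (Ideal.span (Set.range f)) d)))
  have : Module.Finite k (multiplicationModule (Ideal.span (Set.range f)) d hd).dual.M₂ :=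
    (inferInstance : Module.Finite k (Module.Dual k (quotientPiece (Ideal.span (Set.range f)) (d - 1))))
  exact (hX.isLocalGraph hd).nonempty_iso (hX.isLocalGraph_flip hd hdeg)
    (isSheaf_schemePoints _) (isSheaf_grassmannianFunctor _ 1 1)
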